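/- **Definitions.** A *(colored) finite subdivision rule* $R$ of dimension $d$ consists of: a finite CW complex $S_R$ of pure dimension $d$ (it is the union of its closed $d$-cells and has no cells of higher dimension) such that for every $d$-cell the closed $d$-disk carries a CW structure, with the open disk as its only open $d$-cell and the remaining cells in the boundary sphere, in which any two distinct closed cells that intersect do so in a single closed cell of lower dimension, and for which the characteristic map of the $d$-cell is a homeomorphism from each open cell onto an open cell of $S_R$; a finite pure $d$-dimensional CW complex $R(S_R)$ subdividing $S_R$; a partition of the $d$-cells (tiles) of $S_R$ into ideal and non-ideal ones; and a continuous cellular map $\phi_R:R(S_R)\to S_R$ that maps each open cell homeomorphically onto an open cell and maps the union of the closed ideal tiles into itself. An *$R$-complex* is a CW complex $X$ of pure dimension $d$ with a continuous cellular map $f:X\to S_R$ that maps each open cell homeomorphically onto an open cell; it is *finite* if it has finitely many cells. Put $R^0(X)=X$, and let $R^{n+1}(X)$ be the subdivision of $R^n(X)$ obtained by pulling back the cells of $R(S_R)$ under $\phi_R^n\circ f$. A tile ($d$-cell) of $R^n(X)$ is ideal or non-ideal according to its image in $S_R$ under $\phi_R^n\circ f$. $\Lambda_n$ is the union of the closed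 non-ideal tiles of $R^n(X)$; the *ideal set* $\Omega$ is the union over all $n$ of the interior of the union of the closed ideal tiles of $R^n(X)$; the *limit set* is $\Lambda=X\setminus\Omega$. The graph $\Gamma_n$ has a vertex for each cell of $R^n(X)$ contained in $\Lambda_n$ and an edge for each proper inclusion of closed cells; $d_n$ is its path metric. The *history graph* $\Gamma=\Gamma(R,X)$ consists of an origin $O$, the disjoint union of the $\Gamma_n$, edges from $O$ to all vertices of $\Gamma_0$, and an edge from each vertex of $\Gamma_n$, corresponding to an open cell $T$, to each vertex of $\Gamma_{n+1}$ whose open cell is contained in $T$. $\Gamma$ carries its path metric $d_\Gamma$. **Theorem.** Let $R$ be a finite subdivision rule and $X$ a finite $R$-complex. Suppose that $\Gamma=\Gamma(R,X)$ is quasi-isometric to a finitely generated group (that is, to a Cayley graph of the group for a finite generating set). Then the following are equivalent: 1. $\Gamma$ is quasi-isometric to $\mathbb Z$. 2. $\Lambda$ has exactly two connected components, and the diameters of the connected components of the $\Lambda_n$, measured in the history graph, are uniformly bounded: there is $D$ such that $d_\Gamma(a,b)\le D$ for every $n$ and all cells $a,b$ of $\Lambda_n$ lying in the same component of $\Lambda_n$.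 3. $\Lambda$ has exactly two connected components, and the $d_n$-diameters of the components of the $\Lambda_n$, as seen from $\Lambda$, are uniformly bounded: there is $D$ such that $d_n(a,b)\le D$ for every $n$ and all cells $a,b$ of $\Lambda_n$ lying in the same component of $\Lambda_n$ whose open cells meet $\Lambda$. -/

import Mathlib

open Set Metric Topology

universe u v w

/-! ### Cell structures -/

/-- The open `k`-cells of a CW complex, as subsets of the ambient space. -/
def openCells {X : Type u} [TopologicalSpace X] {C : Set X} (c : CWComplex C) (k : ℕ) :
    Set (Set X) :=
  {e | ∃ i : c.cell k, e = c.map k i '' ball 0 1}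

/-- A CW structure on the whole space `X` is of pure dimension `d`: there are no cells of dimension
greater than `d`, and the space is the union of its closed `d`-cells. (In a Hausdorff space the
closed cell is the closure of the open cell.) -/
structure IsPureCW {X : Type u} [TopologicalSpace X] (c : CWComplex (univ : Set X)) (d : ℕ) :
    Prop where
  isEmpty_cell : ∀ k, d < k → IsEmpty (c.cell k)
  exists_mem_closure : ∀ x : X, ∃ e ∈ openCells c d, x ∈ closure e

/-- A continuous cellular map which maps every open cell homeomorphically onto an open cell
(necessarily of the same dimension). -/
structure IsCellHomeo {X : Type u} {Y : Type v} [TopologicalSpace X] [TopologicalSpace Y]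
    (c : CWComplex (univ : Set X)) (c' : CWComplex (univ : Set Y)) (f : X → Y) : Prop where
  continuous : Continuous f
  image_mem : ∀ k, ∀ e ∈ openCells c k, f '' e ∈ openCells c' k
  isEmbedding : ∀ k, ∀ e ∈ openCells c k, IsEmbedding (e.domRestrict f)

/-- The `d`-cell `t` is polyhedral: the closed `d`-disk carries a CW structure `s` with one open
`d`-cell, the open disk, whose remaining cells lie in the boundary sphere, such that any two
distinct closed cells that intersect do so in a single closed cell of lower dimension, and the
characteristic map of `t` restricts to a homeomorphism from each open cell of `s` onto an open cell
of `S`. (The disk is the unit ball of `Fin d → ℝ`, as in Mathlib's CW complexes.) -/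
def IsPolyhedralCell {S : Type u} [TopologicalSpace S] (c : CWComplex (univ : Set S)) (d : ℕ)
    (t : c.cell d) : Prop :=
  ∃ s : CWComplex (closedBall (0 : Fin d → ℝ) 1),
    ball 0 1 ∈ openCells s d ∧
    (∀ k, ∀ a ∈ openCells s k, a ≠ ball 0 1 → a ⊆ sphere 0 1) ∧
    (∀ k, ∀ a ∈ openCells s k,
      c.map d t '' a ∈ openCells c k ∧ IsEmbedding (a.domRestrict (c.map d t))) ∧
    (∀ k l, ∀ a ∈ openCells s k, ∀ b ∈ openCells s l, a ≠ b → (closure a ∩ closure b).Nonempty →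
      ∃ m < max k l, ∃ e ∈ openCells s m, closure a ∩ closure b = closure e)

/-! ### Subdivision rules and their complexes -/

/-- A (colored) finite subdivision rule of dimension `d`. -/
structure SubdivisionRule (d : ℕ) where
  /-- The underlying space of the subdivision complex. -/
  S : Type u
  [top : TopologicalSpace S]
  [t2 : T2Space S]
  /-- The cell structure of the subdivision complex `S_R`. -/
  cw : CWComplex (univ : Set S)
  finite_cw : Finite (Σ k, cw.cell k)
  pure_cw : IsPureCW cw d
  polyhedral : ∀ t : cw.cell d, IsPolyhedralCell cw d t
  /-- The cell structure of the subdivision `R(S_R)` of `S_R`. -/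
  sub : CWComplex (univ : Set S)
  finite_sub : Finite (Σ k, sub.cell k)
  pure_sub : IsPureCW sub d
  /-- Every open cell of `R(S_R)` is contained in an open cell of `S_R`. -/
  sub_refines : ∀ k, ∀ e ∈ openCells sub k, ∃ l, ∃ e' ∈ openCells cw l, e ⊆ e'
  /-- The ideal tiles; the other open `d`-cells of `S_R` are the non-ideal tiles. -/
  ideal : Set (Set S)
  ideal_subset : ideal ⊆ openCells cw d
  /-- The subdivision map `R(S_R) → S_R`. -/
  φ : S → S
  φ_cellHomeo : IsCellHomeo sub cw φ
  φ_ideal : MapsTo φ (⋃ e ∈ ideal, closure e) (⋃ e ∈ ideal, closure e)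

attribute [instance] SubdivisionRule.top SubdivisionRule.t2

/-- An `R`-complex. -/
structure RComplex {d : ℕ} (R : SubdivisionRule.{u} d) where
  /-- The underlying space. -/
  X : Type v
  [top : TopologicalSpace X]
  [t2 : T2Space X]
  cw : CWComplex (univ : Set X)
  pure_cw : IsPureCW cw d
  /-- The structure map to the subdivision complex. -/
  f : X → R.S
  f_cellHomeo : IsCellHomeo cw R.cw f

attribute [instance] RComplex.top RComplex.t2

namespace RComplex

variable {d : ℕ} {R : SubdivisionRule.{u} d} (K : RComplex.{u, v} R)

/-- A finite `R`-complex: one with finitely many cells. -/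
def IsFinite : Prop := Finite (Σ k, K.cw.cell k)

/-- The structure map `φ_R ^ n ∘ f` of the subdivided complex `R^n(X)`. -/
def levelMap (n : ℕ) : K.X → R.S := R.φ^[n] ∘ K.f

/-- The open cells of `R^n(X)`: those of `R^(n+1)(X)` are obtained by pulling back the open cells
of `R(S_R)` to the open cells of `R^n(X)`, each of which is mapped homeomorphically onto an open
cell of `S_R` by the structure map of `R^n(X)`. -/
def cells : ℕ → Set (Set K.X)
  | 0 => {e | ∃ k, e ∈ openCells K.cw k}
  | n + 1 => {e | ∃ e₀ ∈ cells n, ∃ k, ∃ c ∈ openCells R.sub k,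
      c ⊆ K.levelMap n '' e₀ ∧ e = e₀ ∩ K.levelMap n ⁻¹' c}

/-- The ideal (open) tiles of `R^n(X)`: those whose type is an ideal tile of `S_R`. -/
def idealTiles (n : ℕ) : Set (Set K.X) :=
  {e | e ∈ K.cells n ∧ K.levelMap n '' e ∈ R.ideal}

/-- The non-ideal (open) tiles of `R^n(X)`. -/
def nonIdealTiles (n : ℕ) : Set (Set K.X) :=
  {e | e ∈ K.cells n ∧ K.levelMap n '' e ∈ openCells R.cw d ∧ K.levelMap n '' e ∉ R.ideal}

/-- `Λ_n`, the union of the non-ideal closed tiles of `R^n(X)`. -/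
def limitLevel (n : ℕ) : Set K.X := ⋃ e ∈ K.nonIdealTiles n, closure e

/-- The ideal set `Ω`: the union over all levels `n` of the interior of the union of the ideal
closed tiles of `R^n(X)`. -/
def idealSet : Set K.X := ⋃ n, interior (⋃ e ∈ K.idealTiles n, closure e)

/-- The limit set `Λ`, the complement of the ideal set. -/
def limitSet : Set K.X := (K.idealSet)ᶜ

/-! ### The history graph -/

/-- The vertices of `Γ_n`: the (open) cells of `R^n(X)` that are contained in `Λ_n`. -/
def LevelVertex (n : ℕ) : Type v := {e : Set K.X // e ∈ K.cells n ∧ e ⊆ K.limitLevel n}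

/-- The graph `Γ_n`: two distinct cells of `Λ_n` are joined if the closure of one contains the
closure of the other. -/
def levelGraph (n : ℕ) : SimpleGraph (K.LevelVertex n) :=
  SimpleGraph.fromRel fun a b => closure a.1 ⊆ closure b.1

/-- The vertices of the history graph: the origin `none` and the vertices of all `Γ_n`. -/
abbrev HistoryVertex : Type v := Option (Σ n, K.LevelVertex n)

/-- The edges of the history graph (each in one orientation). -/
inductive HistoryEdge : K.HistoryVertex → K.HistoryVertex → Prop
  /-- The origin is joined to every vertex of `Γ_0`. -/
  | origin (a : K.LevelVertex 0) : HistoryEdge none (some ⟨0, a⟩)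
  /-- The edges of the `Γ_n`. -/
  | horizontal (n : ℕ) (a b : K.LevelVertex n) (h : (K.levelGraph n).Adj a b) :
      HistoryEdge (some ⟨n, a⟩) (some ⟨n, b⟩)
  /-- A cell of `Λ_n` is joined to the cells of `Λ_(n+1)` that it contains as open cells. -/
  | vertical (n : ℕ) (a : K.LevelVertex n) (b : K.LevelVertex (n + 1)) (h : b.1 ⊆ a.1) :
      HistoryEdge (some ⟨n, a⟩) (some ⟨n + 1, b⟩)

/-- The history graph `Γ(R,X)`. -/
def historyGraph : SimpleGraph K.HistoryVertex := SimpleGraph.fromRel K.HistoryEdge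

/-- `a` and `b` are cells of a common connected component of the space `Λ_n`. -/
def SameComponent (n : ℕ) (a b : K.LevelVertex n) : Prop :=
  ∃ x ∈ K.limitLevel n, a.1 ⊆ connectedComponentIn (K.limitLevel n) x ∧
    b.1 ⊆ connectedComponentIn (K.limitLevel n) x

end RComplex

/-! ### Quasi-isometry -/

/-- The spaces `(A, dA)` and `(B, dB)` are quasi-isometric. -/
def QuasiIsometric {A : Type u} {B : Type v} (dA : A → A → ℝ) (dB : B → B → ℝ) : Prop :=
  ∃ (f : A → B) (K : ℝ), 0 < K ∧
    (∀ x y, 1 / K * dA x y - K ≤ dB (f x) (f y) ∧ dB (f x) (f y) ≤ K * dA x y + K) ∧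
    ∀ z, ∃ x, dB z (f x) < K

/-- The path metric on the vertex set of a connected graph (which is quasi-isometric to the
geometric realization of the graph with edges of length one). -/
noncomputable def graphDist {V : Type u} (G : SimpleGraph V) (x y : V) : ℝ := G.dist x y

/-!
The sets `Λₙ` are compact and decrease to `Λ`, so two points of `Λ` lie in the same component of
`Λ` exactly when, for every `n`, they lie in the same component of `Λₙ`. The components of `Λₙ`
are those of the graph `Γₙ`, because every closed cell of `Rⁿ(X)` is a connected union of open
cells; this is seen by lifting the characteristic maps of the tiles through the structure maps
`Rⁿ(X) → S_R`, whose fibres are finite. The cells that contain a given limit point form a geodesic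
ray of `Γ` from the origin, and since `S_R` has finitely many cells, every vertex of `Γ` is within
a bounded distance of such a ray.

A quasi-isometry from `Γ` to `ℤ` yields a height function on `Γ` whose sign is constant along
paths that stay far from the origin. Rays in one component of `Λ` therefore have the same sign,
and rays of the same sign stay at bounded distance from each other at equal depth. Neither sign
can be missing, so `Λ` has exactly two components. For the bound in `Γₙ` itself, take two rays of
the same sign far below level `n`: a short path of `Γ` between them stays below level `n` and
projects to `Γₙ`.

Conversely, if `Λ` has two components, then rays to points of different components diverge at full
speed, up to a constant, and the uniform bound makes every vertex of `Γ` close to one of two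
chosen rays. The union of these two rays is then a coarse copy of `ℤ`.
-/

section GeneralTopology

open Filter

theorem isPreconnected_iInter_of_directed {ι : Type*} [Nonempty ι] {X : Type*} [TopologicalSpace X]
    [CompactSpace X] [T2Space X] {s : ι → Set X} (hs : Directed (· ⊇ ·) s)
    (hc : ∀ i, IsClosed (s i)) (hp : ∀ i, IsPreconnected (s i)) : IsPreconnected (⋂ i, s i) := by
  rw [isPreconnected_iff_subset_of_fully_disjoint_closed (isClosed_iInter hc)]
  intro u v hu hv hsub huv
  obtain ⟨U, V, hU, hV, huU, hvV, hUV⟩ :=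
    SeparatedNhds.of_isCompact_isCompact hu.isCompact hv.isCompact huv
  obtain ⟨i, hi⟩ := exists_subset_nhds_of_compactSpace hs hc (U := U ∪ V) fun x hx =>
    (hU.union hV).mem_nhds (union_subset_union huU hvV (hsub hx))
  refine (isPreconnected_iff_subset_of_disjoint.1 (hp i) U V hU hV hi
    (by rw [hUV.inter_eq, inter_empty])).imp (fun h x hx => ?_) (fun h x hx => ?_)
  · exact (hsub hx).resolve_right fun hxv =>
      disjoint_left.1 hUV (h (mem_iInter.1 hx i)) (hvV hxv)
  · exact (hsub hx).resolve_left fun hxu =>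
      disjoint_left.1 hUV (huU hxu) (h (mem_iInter.1 hx i))

theorem isTotallyDisconnected_of_finite {X : Type*} [TopologicalSpace X] [T1Space X] {s : Set X}
    (hs : s.Finite) : IsTotallyDisconnected s := fun _ ht hpre =>
  not_nontrivial_iff.1 fun hnt => hpre.infinite_of_nontrivial hnt (hs.subset ht)

theorem exists_tendsto_of_isTotallyDisconnected_fiber {α X S : Type*} [TopologicalSpace X]
    [CompactSpace X] [T2Space X] [TopologicalSpace S] [T2Space S] {F : X → S} (hF : Continuous F)
    {y : S} (hy : IsTotallyDisconnected (F ⁻¹' {y})) {g : α → X} {l : Filter α} [l.NeBot]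
    (hg : Tendsto (F ∘ g) l (𝓝 y)) (hl : ∀ U ∈ l, ∃ V ∈ l, V ⊆ U ∧ IsPreconnected (g '' V)) :
    ∃ x, Tendsto g l (𝓝 x) := by
  let P : Set (Set α) := {V | V ∈ l ∧ IsPreconnected (g '' V)}
  have hPne : Nonempty P := by
    obtain ⟨V, hV, -, hpre⟩ := hl univ univ_mem
    exact ⟨V, hV, hpre⟩
  have hdir : Directed (· ⊇ ·) fun V : P => closure (g '' V.1) := fun V W => by
    obtain ⟨T, hT, hTVW, hpre⟩ := hl (V.1 ∩ W.1) (inter_mem V.2.1 W.2.1)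
    exact ⟨⟨T, hT, hpre⟩, closure_mono (image_mono (hTVW.trans inter_subset_left)),
      closure_mono (image_mono (hTVW.trans inter_subset_right))⟩
  have hZpre : IsPreconnected (⋂ V : P, closure (g '' V.1)) :=
    isPreconnected_iInter_of_directed hdir (fun _ => isClosed_closure) fun V => V.2.2.closure
  have hZ : ∀ x, ClusterPt x (map g l) → x ∈ ⋂ V : P, closure (g '' V.1) := fun x hx =>
    mem_iInter.2 fun V => clusterPt_iff_forall_mem_closure.1 hx _ (image_mem_map V.2.1)
  have hZy : (⋂ V : P, closure (g '' V.1)) ⊆ F ⁻¹' {y} := fun x hx => by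
    have hcl : ClusterPt x (map g l) := clusterPt_iff_forall_mem_closure.2 fun s hs => by
      obtain ⟨V, hV, hVs, hpre⟩ := hl _ hs
      exact closure_mono (image_subset_iff.2 hVs) (mem_iInter.1 hx ⟨V, hV, hpre⟩)
    have hFcl : ClusterPt (F x) (𝓝 y) := (hcl.map hF.continuousAt tendsto_map).mono hg
    by_contra hne
    exact clusterPt_iff_not_disjoint.1 hFcl (disjoint_nhds_nhds.2 hne)
  obtain ⟨x, hx⟩ := exists_clusterPt_of_compactSpace (map g l)
  exact ⟨x, le_nhds_of_unique_clusterPt fun x' hx' => hy _ hZy hZpre (hZ x' hx') (hZ x hx)⟩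

theorem exists_continuousOn_lift_of_isEmbedding {E X S : Type*} [TopologicalSpace E]
    [TopologicalSpace X] [TopologicalSpace S] {F : X → S} {e : Set X}
    (he : IsEmbedding (e.domRestrict F)) {s : Set E} (hs : s.Nonempty) {Ψ : E → S}
    (hΨ : ContinuousOn Ψ s) (hΨe : MapsTo Ψ s (F '' e)) :
    ∃ g : E → X, ContinuousOn g s ∧ MapsTo g s e ∧ EqOn (F ∘ g) Ψ s := by
  obtain ⟨x₀, -, -⟩ := hΨe hs.some_mem
  have : Nonempty X := ⟨x₀⟩
  let g : E → X := Function.invFunOn F e ∘ Ψ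
  have hge : MapsTo g s e := fun z hz => Function.invFunOn_mem (hΨe hz)
  have hFg : EqOn (F ∘ g) Ψ s := fun z hz => Function.invFunOn_eq (hΨe hz)
  refine ⟨g, ?_, hge, hFg⟩
  have hcomp : e.domRestrict F ∘ hge.restrict = s.domRestrict Ψ := funext fun z => hFg z.2
  have hcont : Continuous hge.restrict := he.continuous_iff.2 (hcomp ▸ hΨ.domRestrict)
  exact continuousOn_iff_continuous_domRestrict.2 (continuous_subtype_val.comp hcont)

theorem exists_continuousOn_closure_lift {E X S : Type*} [AddCommGroup E] [Module ℝ E]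
    [TopologicalSpace E] [ContinuousAdd E] [ContinuousSMul ℝ E] [LocallyConvexSpace ℝ E]
    [TopologicalSpace X] [CompactSpace X] [T2Space X] [TopologicalSpace S] [T2Space S]
    {F : X → S} (hF : Continuous F) (hfib : ∀ y, IsTotallyDisconnected (F ⁻¹' {y})) {e : Set X}
    (he : IsEmbedding (e.domRestrict F)) {s : Set E} (hs : Convex ℝ s) (hne : s.Nonempty)
    {Ψ : E → S} (hΨ : ContinuousOn Ψ (closure s)) (hΨe : MapsTo Ψ s (F '' e)) :
    ∃ g : E → X, ContinuousOn g (closure s) ∧ MapsTo g s e ∧ EqOn (F ∘ g) Ψ (closure s) := by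
  obtain ⟨g, hgc, hge, hFg⟩ :=
    exists_continuousOn_lift_of_isEmbedding he hne (hΨ.mono subset_closure) hΨe
  have hΨlim : ∀ p ∈ closure s, Tendsto (F ∘ g) (𝓝[s] p) (𝓝 (Ψ p)) := fun p hp =>
    ((hΨ p hp).mono subset_closure).tendsto.congr'
      (hFg.symm.eventuallyEq_of_mem self_mem_nhdsWithin)
  have hlim : ∀ p ∈ closure s, ∃ x, Tendsto g (𝓝[s] p) (𝓝 x) := fun p hp => by
    have : (𝓝[s] p).NeBot := mem_closure_iff_nhdsWithin_neBot.1 hp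
    refine exists_tendsto_of_isTotallyDisconnected_fiber hF (hfib (Ψ p)) (hΨlim p hp) ?_
    intro U hU
    obtain ⟨W, ⟨hW, hWconv⟩, hWU⟩ :=
      (nhdsWithin_hasBasis (LocallyConvexSpace.convex_basis (𝕜 := ℝ) p) s).mem_iff.1 hU
    have hWs : W ∩ s ∈ 𝓝[s] p := inter_mem (mem_nhdsWithin_of_mem_nhds hW) self_mem_nhdsWithin
    exact ⟨W ∩ s, hWs, hWU,
      (hWconv.inter hs).isPreconnected.image _ (hgc.mono inter_subset_right)⟩
  have hext : EqOn (extendFrom s g) g s := extendFrom_extends hgc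
  have hextc : ContinuousOn (extendFrom s g) (closure s) :=
    continuousOn_extendFrom subset_rfl hlim
  refine ⟨extendFrom s g, hextc, fun z hz => hext hz ▸ hge hz, fun p hp => ?_⟩
  have : (𝓝[s] p).NeBot := mem_closure_iff_nhdsWithin_neBot.1 hp
  have hFext : Tendsto (F ∘ extendFrom s g) (𝓝[s] p) (𝓝 (F (extendFrom s g p))) :=
    (hF.tendsto _).comp ((hextc p hp).mono subset_closure)
  refine tendsto_nhds_unique hFext ((hΨlim p hp).congr' ?_)
  exact EqOn.eventuallyEq_of_mem (fun z hz => congrArg F (hext hz).symm) self_mem_nhdsWithin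

theorem subset_closure_inter_preimage_of_dense {X S : Type*} [TopologicalSpace X]
    [TopologicalSpace S] {F : X → S} {e : Set X} (he : IsEmbedding (e.domRestrict F))
    (ho : IsOpen (F '' e)) {D : Set S} (hD : Dense D) : e ⊆ closure (e ∩ F ⁻¹' D) := by
  have hopen : IsOpenEmbedding (e.domRestrict F) := ⟨he, range_domRestrict F e ▸ ho⟩
  have hdense := hD.preimage hopen.isOpenMap
  rw [Subtype.dense_iff] at hdense
  exact hdense.trans (closure_mono (image_subset_iff.2 fun x hx => ⟨x.2, hx⟩))

theorem subset_of_isPreconnected_of_disjoint_closure {X : Type*} [TopologicalSpace X]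
    {Q : Set (Set X)} (hQ : Q.Finite) (hdisj : Q.Pairwise fun b b' => Disjoint (closure b) b')
    {A b : Set X} (hA : IsPreconnected A) (hAQ : A ⊆ ⋃₀ Q) (hb : b ∈ Q) (hAb : (A ∩ b).Nonempty) :
    A ⊆ b := by
  have hsep : Disjoint b (⋃ b' ∈ Q \ {b}, closure b') := disjoint_iUnion₂_right.2 fun b' hb' =>
    (hdisj hb'.1 hb hb'.2).symm
  have hclosed : IsClosed (⋃ b' ∈ Q \ {b}, closure b') :=
    hQ.sdiff.isClosed_biUnion fun _ _ => isClosed_closure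
  have hcl : ∀ w ∈ A, w ∈ closure b → w ∈ b := fun w hw hwb => by
    obtain ⟨b', hb', hwb'⟩ := hAQ hw
    rcases eq_or_ne b b' with rfl | hne
    · exact hwb'
    · exact (disjoint_left.1 (hdisj hb hb' hne) hwb hwb').elim
  have hcover : A ⊆ closure b ∪ ⋃ b' ∈ Q \ {b}, closure b' := fun w hw => by
    obtain ⟨b', hb', hwb'⟩ := hAQ hw
    rcases eq_or_ne b' b with rfl | hne
    · exact Or.inl (subset_closure hwb')
    · exact Or.inr (mem_biUnion (⟨hb', hne⟩ : b' ∈ Q \ {b}) (subset_closure hwb'))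
  rcases isPreconnected_iff_subset_of_disjoint_closed.1 hA _ _ isClosed_closure hclosed hcover
    (eq_empty_of_forall_notMem fun w ⟨hw, hwb, hwQ⟩ =>
      disjoint_left.1 hsep (hcl w hw hwb) hwQ) with hsub | hsub
  · exact fun w hw => hcl w hw (hsub hw)
  · obtain ⟨z, hz, hzb⟩ := hAb
    exact (disjoint_left.1 hsep hzb (hsub hz)).elim

theorem isPreconnected_of_isEmbedding_domRestrict {X S : Type*} [TopologicalSpace X]
    [TopologicalSpace S] {F : X → S} {e : Set X} (he : IsEmbedding (e.domRestrict F))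
    (hFe : IsPreconnected (F '' e)) : IsPreconnected e := by
  rw [← range_domRestrict, ← image_univ, he.isInducing.isPreconnected_image] at hFe
  exact isPreconnected_iff_preconnectedSpace.2 ⟨hFe⟩

end GeneralTopology

section CoarseGraphs

variable {V : Type u} {G : SimpleGraph V}

theorem dist_add_dist_le_length_of_mem_support {x y z : V} (p : G.Walk x y)
    (hz : z ∈ p.support) : G.dist x z + G.dist z y ≤ p.length := by
  classical
  rw [← p.take_spec hz, SimpleGraph.Walk.length_append]
  exact add_le_add (SimpleGraph.dist_le _) (SimpleGraph.dist_le _)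

/-- A function `g` on the vertices of a graph with base point `o` that behaves like the first
coordinate of a quasi-isometry to the line taking `o` to `0`: its increments along edges are at most
`δ`, vertices whose heights differ by at most `δ` are at distance at most `B`, and it is unbounded
in both directions. -/
structure IsCoarseHeight (G : SimpleGraph V) (o : V) (g : V → ℝ) (δ : ℝ) (B : ℕ) : Prop where
  zero : g o = 0
  nonneg : 0 ≤ δ
  abs_sub_le : ∀ x y, G.Adj x y → |g x - g y| ≤ δ
  dist_le : ∀ x y, |g x - g y| ≤ δ → G.dist x y ≤ B
  exists_ge : ∀ M, ∃ x, M ≤ g x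
  exists_le : ∀ M, ∃ x, g x ≤ M

namespace IsCoarseHeight

variable {o x y : V} {g : V → ℝ} {δ : ℝ} {B : ℕ}

theorem neg (h : IsCoarseHeight G o g δ B) : IsCoarseHeight G o (-g) δ B where
  zero := by rw [Pi.neg_apply, h.zero, neg_zero]
  nonneg := h.nonneg
  abs_sub_le x y hxy := by
    rw [Pi.neg_apply, Pi.neg_apply, neg_sub_neg]
    exact h.abs_sub_le y x hxy.symm
  dist_le x y hxy := by
    rw [Pi.neg_apply, Pi.neg_apply, neg_sub_neg] at hxy
    exact SimpleGraph.dist_comm.trans_le (h.dist_le y x hxy)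
  exists_ge M := (h.exists_le (-M)).imp fun _ hx => le_neg_of_le_neg hx
  exists_le M := (h.exists_ge (-M)).imp fun _ hx => neg_le_of_neg_le hx

theorem lt_abs_of_lt_dist (h : IsCoarseHeight G o g δ B) (hx : B < G.dist o x) : δ < |g x| := by
  by_contra! hle
  rw [← abs_neg, ← zero_sub, ← h.zero] at hle
  exact hx.not_ge (h.dist_le o x hle)

theorem sign_ne_zero (h : IsCoarseHeight G o g δ B) (hx : B < G.dist o x) :
    SignType.sign (g x) ≠ 0 :=
  _root_.sign_ne_zero.2 (abs_pos.1 (h.nonneg.trans_lt (h.lt_abs_of_lt_dist hx)))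

theorem sign_eq_of_adj (h : IsCoarseHeight G o g δ B) (hx : B < G.dist o x) (hxy : G.Adj x y) :
    SignType.sign (g x) = SignType.sign (g y) := by
  obtain ⟨hlow, hhigh⟩ := abs_le.1 (h.abs_sub_le x y hxy)
  rcases lt_abs.1 (h.lt_abs_of_lt_dist hx) with hpos | hneg
  · rw [sign_pos (by linarith [h.nonneg]), sign_pos (by linarith)]
  · rw [sign_neg (by linarith [h.nonneg]), sign_neg (by linarith)]

theorem sign_eq_of_walk (h : IsCoarseHeight G o g δ B) (p : G.Walk x y)
    (hp : ∀ z ∈ p.support, B < G.dist o z) : SignType.sign (g x) = SignType.sign (g y) := by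
  induction p with
  | nil => rfl
  | @cons x z y hxz p ih =>
    exact (h.sign_eq_of_adj (hp x (by simp)) hxz).trans
      (ih fun w hw => hp w (List.mem_cons_of_mem x hw))

theorem exists_mem_support (h : IsCoarseHeight G o g δ B) (p : G.Walk x y) {t : ℝ}
    (hx : g x ≤ t + δ) (hy : t ≤ g y) : ∃ z ∈ p.support, t ≤ g z ∧ g z ≤ t + δ := by
  induction p with
  | nil => exact ⟨_, by simp, hy, hx⟩
  | @cons x z y hxz p ih =>
    by_cases hxt : t ≤ g x
    · exact ⟨x, by simp, hxt, hx⟩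
    · have hstep := (abs_le.1 (h.abs_sub_le x z hxz)).1
      obtain ⟨w, hw, hw'⟩ := ih (by linarith) hy
      exact ⟨w, List.mem_cons_of_mem x hw, hw'⟩

/-- A geodesic from `o` to the higher of the two vertices passes at distance at most `B` from the
other one. -/
theorem dist_le_of_nonneg (h : IsCoarseHeight G o g δ B) (hG : G.Connected)
    (hxy : G.dist o x = G.dist o y) (hx : 0 ≤ g x) (hy : 0 ≤ g y) : G.dist x y ≤ 2 * B := by
  wlog hle : g x ≤ g y generalizing x y
  · exact SimpleGraph.dist_comm.trans_le (this hxy.symm hy hx (le_of_not_ge hle))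
  obtain ⟨p, hp⟩ := hG.exists_walk_length_eq_dist o y
  obtain ⟨z, hz, hxz, hzx⟩ := h.exists_mem_support p (t := g x)
    (h.zero.trans_le (add_nonneg hx h.nonneg)) hle
  have hB : G.dist x z ≤ B := h.dist_le x z (abs_le.2 ⟨by linarith, by linarith [h.nonneg]⟩)
  have hgeodesic := dist_add_dist_le_length_of_mem_support p hz
  have hoz := hG.dist_triangle (u := o) (v := z) (w := x)
  have hxy' := hG.dist_triangle (u := x) (v := z) (w := y)
  rw [SimpleGraph.dist_comm (u := z) (v := x)] at hoz
  omega

theorem dist_le_of_sign_eq (h : IsCoarseHeight G o g δ B) (hG : G.Connected)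
    (hxy : G.dist o x = G.dist o y) (hsign : SignType.sign (g x) = SignType.sign (g y)) :
    G.dist x y ≤ 2 * B := by
  rcases le_total 0 (g x) with hx | hx
  · refine h.dist_le_of_nonneg hG hxy hx ?_
    rwa [← sign_nonneg_iff, ← hsign, sign_nonneg_iff]
  · refine h.neg.dist_le_of_nonneg hG hxy (neg_nonneg.2 hx) (neg_nonneg.2 ?_)
    rwa [← sign_nonpos_iff, ← hsign, sign_nonpos_iff]

theorem le_mul_length (h : IsCoarseHeight G o g δ B) (p : G.Walk x y) :
    g y ≤ g x + δ * p.length := by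
  induction p with
  | nil => simp
  | @cons x z y hxz p ih =>
    have hstep := (abs_le.1 (h.abs_sub_le x z hxz)).1
    rw [SimpleGraph.Walk.length_cons]
    push_cast
    linarith

theorem le_mul_dist (h : IsCoarseHeight G o g δ B) (hG : G.Connected) (x : V) :
    g x ≤ δ * G.dist o x := by
  obtain ⟨p, hp⟩ := hG.exists_walk_length_eq_dist o x
  have hle := h.le_mul_length p
  rwa [h.zero, zero_add, hp] at hle

theorem exists_pos_of_lt_dist (h : IsCoarseHeight G o g δ B) (hG : G.Connected) (N : ℕ) :
    ∃ x, N < G.dist o x ∧ 0 < g x := by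
  have hδN : 0 ≤ δ * N := mul_nonneg h.nonneg N.cast_nonneg
  obtain ⟨x, hx⟩ := h.exists_ge (δ * N + 1)
  refine ⟨x, ?_, by linarith⟩
  by_contra! hle
  have hmul := mul_le_mul_of_nonneg_left (Nat.cast_le (α := ℝ).2 hle) h.nonneg
  linarith [h.le_mul_dist hG x]

end IsCoarseHeight

theorem exists_isCoarseHeight_of_quasiIsometric (o : V)
    (h : QuasiIsometric (graphDist G) (fun m n : ℤ => dist m n)) :
    ∃ g δ B, IsCoarseHeight G o g δ B := by
  obtain ⟨f, C, hC, hf, hsurj⟩ := h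
  beta_reduce at hf hsurj
  have hdist : ∀ x y, |((f x : ℝ) - f o) - (f y - f o)| = dist (f x) (f y) := fun x y => by
    rw [Int.dist_eq, sub_sub_sub_cancel_right]
  have hnear : ∀ k : ℤ, ∃ x, |(k : ℝ) - (f x - f o)| < C := fun k => by
    obtain ⟨x, hx⟩ := hsurj (f o + k)
    refine ⟨x, ?_⟩
    rw [Int.dist_eq] at hx
    convert hx using 2
    push_cast
    ring
  refine ⟨fun x => f x - f o, 2 * C, ⌈3 * C ^ 2⌉₊, by simp, by positivity, fun x y hxy => ?_,
    fun x y hxy => ?_, fun M => ?_, fun M => ?_⟩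
  · rw [hdist]
    have hle := (hf x y).2
    rw [graphDist, SimpleGraph.dist_eq_one_iff_adj.2 hxy] at hle
    push_cast at hle
    linarith
  · rw [hdist] at hxy
    have hle : 1 / C * graphDist G x y ≤ 3 * C := by linarith [(hf x y).1]
    rw [one_div, inv_mul_le_iff₀ hC] at hle
    have hceil : (G.dist x y : ℝ) ≤ ⌈3 * C ^ 2⌉₊ := by
      refine le_trans ?_ (Nat.le_ceil _)
      rw [graphDist] at hle
      linarith
    exact_mod_cast hceil
  · obtain ⟨x, hx⟩ := hnear ⌈M + C⌉
    exact ⟨x, by linarith [Int.le_ceil (M + C), (abs_lt.1 hx).2]⟩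
  · obtain ⟨x, hx⟩ := hnear ⌊M - C⌋
    exact ⟨x, by linarith [Int.floor_le (M - C), (abs_lt.1 hx).1]⟩

theorem abs_graphDist_sub_le (hG : G.Connected) (x y x' y' : V) :
    |graphDist G x y - graphDist G x' y'| ≤ graphDist G x x' + graphDist G y y' := by
  have hle : ∀ x y x' y' : V,
      graphDist G x y ≤ graphDist G x x' + graphDist G x' y' + graphDist G y y' := by
    intro x y x' y'
    have hx := hG.dist_triangle (u := x) (v := x') (w := y)
    have hy := hG.dist_triangle (u := x') (v := y') (w := y)
    rw [SimpleGraph.dist_comm (u := y') (v := y)] at hy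
    simp only [graphDist]
    exact_mod_cast (by omega)
  have hle' := hle x' y' x y
  have hcomm : ∀ u v : V, graphDist G u v = graphDist G v u := fun u v =>
    congrArg Nat.cast SimpleGraph.dist_comm
  rw [hcomm x' x, hcomm y' y] at hle'
  exact abs_sub_le_iff.2 ⟨by linarith [hle x y x' y'], by linarith⟩

theorem quasiIsometric_of_coarse_isometry {Y : Type v} [PseudoMetricSpace Y] (hG : G.Connected)
    {ι : Y → V} {E F : ℕ} (hι : ∀ x, ∃ j, G.dist x (ι j) ≤ E)
    (hF : ∀ j k, |graphDist G (ι j) (ι k) - dist j k| ≤ F) :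
    QuasiIsometric (graphDist G) (fun j k : Y => dist j k) := by
  choose f hf using hι
  have hE : ∀ x, graphDist G x (ι (f x)) ≤ E := fun x => Nat.cast_le.2 (hf x)
  have hdist : ∀ x y, |graphDist G x y - dist (f x) (f y)| ≤ 2 * E + F := fun x y => by
    have hxy := abs_graphDist_sub_le hG x y (ι (f x)) (ι (f y))
    linarith [abs_sub_le (graphDist G x y) (graphDist G (ι (f x)) (ι (f y))) (dist (f x) (f y)),
      hF (f x) (f y), hE x, hE y]
  have hnonneg : (0 : ℝ) ≤ 2 * E + F := by positivity
  refine ⟨f, 2 * E + F + 1, by positivity, fun x y => ?_, fun j => ⟨ι j, ?_⟩⟩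
  · have h0 : 0 ≤ graphDist G x y := Nat.cast_nonneg _
    obtain ⟨hlow, hhigh⟩ := abs_le.1 (hdist x y)
    constructor
    · have hdiv : 1 / (2 * (E : ℝ) + F + 1) * graphDist G x y ≤ graphDist G x y :=
        mul_le_of_le_one_left h0 ((div_le_one (by linarith)).2 (by linarith))
      linarith
    · have hmul := mul_le_mul_of_nonneg_right (le_add_of_nonneg_left (a := (1 : ℝ)) hnonneg) h0
      linarith
  · have hlow := (abs_le.1 (hF j (f (ι j)))).1
    linarith [hE (ι j), E.cast_nonneg (α := ℝ)]

theorem quasiIsometric_int_of_rays (hG : G.Connected) {α β : ℕ → V} {C E : ℕ}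
    (hα : ∀ i j, (G.dist (α i) (α j) : ℤ) = |(i : ℤ) - j|)
    (hβ : ∀ i j, (G.dist (β i) (β j) : ℤ) = |(i : ℤ) - j|)
    (hαβ : ∀ i j, G.dist (α i) (β j) ≤ i + j + C ∧ i + j ≤ G.dist (α i) (β j) + C)
    (hE : ∀ x, ∃ n, G.dist x (α n) ≤ E ∨ G.dist x (β n) ≤ E) :
    QuasiIsometric (graphDist G) (fun m n : ℤ => dist m n) := by
  let ι : ℤ → V := fun
    | Int.ofNat n => α n
    | Int.negSucc n => β n
  refine quasiIsometric_of_coarse_isometry hG (ι := ι) (E := E) (F := C + 1) (fun x => ?_)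
    fun j k => ?_
  · obtain ⟨n, hn | hn⟩ := hE x
    · exact ⟨Int.ofNat n, hn⟩
    · exact ⟨Int.negSucc n, hn⟩
  · have hint : |(G.dist (ι j) (ι k) : ℤ) - (|j - k| : ℤ)| ≤ C + 1 := by
      rcases j with i | i <;> rcases k with j | j <;>
        simp only [ι, hα, hβ] <;> simp only [Int.ofNat_eq_natCast, Int.negSucc_eq]
      · simp only [sub_self, abs_zero]
        omega
      · have := hαβ i j
        simp only [abs_eq_max_neg]
        omega
      · have := hαβ j i
        rw [SimpleGraph.dist_comm]
        simp only [abs_eq_max_neg]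
        omega
      · simp only [abs_eq_max_neg]
        omega
    rw [graphDist, Int.dist_eq]
    exact_mod_cast hint

end CoarseGraphs

section OpenCells

variable {X : Type u} [TopologicalSpace X] {C : Set X} {c : CWComplex C} {k l : ℕ} {e e' : Set X}
  {x : X}

theorem sigma_eq_of_mem_ball_image {i : c.cell k} {j : c.cell l} (hx : x ∈ c.map k i '' ball 0 1)
    (hx' : x ∈ c.map l j '' ball 0 1) : (⟨k, i⟩ : Σ n, c.cell n) = ⟨l, j⟩ :=
  let := c
  RelCWComplex.eq_of_not_disjoint_openCell (C := C) (not_disjoint_iff.2 ⟨x, hx, hx'⟩)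

theorem dim_eq_of_mem_openCells (he : e ∈ openCells c k) (he' : e' ∈ openCells c l) (hx : x ∈ e)
    (hx' : x ∈ e') : k = l := by
  obtain ⟨i, rfl⟩ := he
  obtain ⟨j, rfl⟩ := he'
  exact congrArg Sigma.fst (sigma_eq_of_mem_ball_image hx hx')

theorem eq_of_mem_openCells (he : e ∈ openCells c k) (he' : e' ∈ openCells c l) (hx : x ∈ e)
    (hx' : x ∈ e') : e = e' := by
  obtain ⟨i, rfl⟩ := he
  obtain ⟨j, rfl⟩ := he'
  cases sigma_eq_of_mem_ball_image hx hx'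
  rfl

theorem nonempty_of_mem_openCells (he : e ∈ openCells c k) : e.Nonempty := by
  obtain ⟨i, rfl⟩ := he
  exact (nonempty_ball.2 one_pos).image _

theorem isPreconnected_of_mem_openCells (he : e ∈ openCells c k) : IsPreconnected e := by
  obtain ⟨i, rfl⟩ := he
  exact (convex_ball _ _).isPreconnected.image _ ((c.continuousOn k i).mono ball_subset_closedBall)

theorem subset_of_mem_openCells (he : e ∈ openCells c k) : e ⊆ C := by
  let := c
  obtain ⟨i, rfl⟩ := he
  exact RelCWComplex.openCell_subset_complex (C := C) k i

theorem exists_mem_openCells (hx : x ∈ C) : ∃ k, ∃ e ∈ openCells c k, x ∈ e := by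
  let := c
  rw [← CWComplex.iUnion_openCell_eq_complex (C := C)] at hx
  obtain ⟨k, i, hx⟩ := mem_iUnion₂.1 hx
  exact ⟨k, _, ⟨i, rfl⟩, hx⟩

theorem finite_openCells (hc : Finite (Σ k, c.cell k)) : {e | ∃ k, e ∈ openCells c k}.Finite := by
  refine (finite_range fun i : Σ k, c.cell k => c.map i.1 i.2 '' ball 0 1).subset ?_
  rintro e ⟨k, i, rfl⟩
  exact ⟨⟨k, i⟩, rfl⟩

variable [T2Space X]

theorem isCompact_closure_of_mem_openCells (he : e ∈ openCells c k) : IsCompact (closure e) := by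
  let := c
  obtain ⟨i, rfl⟩ := he
  have hcl := RelCWComplex.closure_openCell_eq_closedCell (C := C) (n := k) (j := i)
  exact hcl.symm ▸ RelCWComplex.isCompact_closedCell (C := C) (n := k) (i := i)

theorem mem_or_exists_lt_of_mem_closure (he : e ∈ openCells c k) (hx : x ∈ closure e) :
    x ∈ e ∨ ∃ l < k, ∃ e' ∈ openCells c l, x ∈ e' := by
  let := c
  obtain ⟨i, rfl⟩ := he
  replace hx : x ∈ RelCWComplex.closedCell (C := C) k i :=
    RelCWComplex.closure_openCell_eq_closedCell.le hx
  rw [← RelCWComplex.cellFrontier_union_openCell_eq_closedCell] at hx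
  refine hx.symm.imp id fun hfr => ?_
  obtain ⟨I, hI⟩ := CWComplex.cellFrontier_subset_finite_openCell (C := C) k i
  have hxI := hI hfr
  simp only [mem_iUnion, exists_prop] at hxI
  obtain ⟨l, hl, j, -, hj⟩ := hxI
  exact ⟨l, hl, _, ⟨j, rfl⟩, hj⟩

theorem lt_of_mem_closure_openCells (he : e ∈ openCells c k) (he' : e' ∈ openCells c l)
    (hne : e ≠ e') (hx : x ∈ closure e) (hx' : x ∈ e') : l < k := by
  rcases mem_or_exists_lt_of_mem_closure he hx with hxe | ⟨m, hm, e'', he'', hxe''⟩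
  · exact absurd (eq_of_mem_openCells he he' hxe hx') hne
  · exact dim_eq_of_mem_openCells he'' he' hxe'' hx' ▸ hm

theorem subset_closure_of_inter_eq_closure
    (hC : ∀ k l, ∀ a ∈ openCells c k, ∀ b ∈ openCells c l, a ≠ b →
      (closure a ∩ closure b).Nonempty →
      ∃ m < max k l, ∃ e ∈ openCells c m, closure a ∩ closure b = closure e)
    (he : e ∈ openCells c k) (he' : e' ∈ openCells c l) (hx : x ∈ closure e) (hx' : x ∈ e') :
    e' ⊆ closure e := by
  rcases eq_or_ne e e' with rfl | hne
  · exact subset_closure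
  obtain ⟨m, -, a, ha, hae⟩ := hC k l e he e' he' hne ⟨x, hx, subset_closure hx'⟩
  have hae' : a = e' := by
    by_contra hne'
    have hxa : x ∈ closure a := hae ▸ ⟨hx, subset_closure hx'⟩
    obtain ⟨y, hy⟩ := nonempty_of_mem_openCells ha
    have hye' : y ∈ closure e' := (hae.ge (subset_closure hy)).2
    exact lt_asymm (lt_of_mem_closure_openCells ha he' hne' hxa hx')
      (lt_of_mem_closure_openCells he' ha (Ne.symm hne') hye' hy)
  exact subset_closure.trans (hae'.symm ▸ hae.ge.trans inter_subset_left)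

end OpenCells

section PureComplexes

variable {X : Type u} [TopologicalSpace X] {c : CWComplex (univ : Set X)} {d k : ℕ} {e : Set X}

theorem compactSpace_of_finite_cells [T2Space X] (hc : Finite (Σ k, c.cell k)) :
    CompactSpace X := by
  have hcover : (univ : Set X) = ⋃ e ∈ {e | ∃ k, e ∈ openCells c k}, closure e := by
    refine (eq_univ_of_forall fun x => ?_).symm
    obtain ⟨k, e, he, hx⟩ := exists_mem_openCells (c := c) (mem_univ x)
    exact mem_iUnion₂.2 ⟨e, ⟨k, he⟩, subset_closure hx⟩
  refine ⟨hcover ▸ (finite_openCells hc).isCompact_biUnion ?_⟩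
  rintro e ⟨k, he⟩
  exact isCompact_closure_of_mem_openCells he

theorem IsPureCW.dim_le (h : IsPureCW c d) (he : e ∈ openCells c k) : k ≤ d := by
  obtain ⟨i, -⟩ := he
  exact not_lt.1 fun hk => (h.isEmpty_cell k hk).false i

theorem IsPureCW.isOpen [T2Space X] (h : IsPureCW c d) (hc : Finite (Σ k, c.cell k))
    (he : e ∈ openCells c d) : IsOpen e := by
  have hcompl : eᶜ = ⋃ a ∈ {a | ∃ k, a ∈ openCells c k} \ {e}, closure a := by
    refine Subset.antisymm (fun x hx => ?_) (iUnion₂_subset ?_)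
    · obtain ⟨k, a, ha, hxa⟩ := exists_mem_openCells (c := c) (mem_univ x)
      exact mem_iUnion₂.2 ⟨a, ⟨⟨k, ha⟩, fun hae => hx (hae ▸ hxa)⟩, subset_closure hxa⟩
    · rintro a ⟨⟨k, ha⟩, hne⟩ x hxa hx
      exact (lt_of_mem_closure_openCells ha he hne hxa hx).not_ge (h.dim_le ha)
  rw [← isClosed_compl_iff, hcompl]
  exact (finite_openCells hc).sdiff.isClosed_biUnion fun _ _ => isClosed_closure

theorem IsPureCW.dense (h : IsPureCW c d) : Dense (⋃ e ∈ openCells c d, e) := fun x => by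
  obtain ⟨e, he, hx⟩ := h.exists_mem_closure x
  exact closure_mono (subset_biUnion_of_mem (u := id) he) hx

end PureComplexes

namespace SubdivisionRule

variable {d : ℕ} (R : SubdivisionRule.{u} d)

/-- The union of the open tiles of `S_R`. -/
def tileRegion : Set R.S := ⋃ e ∈ openCells R.cw d, e

/-- The union of the open non-ideal tiles of `S_R`. -/
def nonIdealRegion : Set R.S := ⋃ e ∈ openCells R.cw d \ R.ideal, e

theorem isOpen_nonIdealRegion : IsOpen R.nonIdealRegion :=
  isOpen_biUnion fun _ he => R.pure_cw.isOpen R.finite_cw he.1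

variable {R} {x : R.S}

theorem mem_tileRegion : x ∈ R.tileRegion ↔ ∃ e ∈ openCells R.cw d, x ∈ e := by
  simp [tileRegion]

theorem mem_nonIdealRegion : x ∈ R.nonIdealRegion ↔ ∃ e ∈ openCells R.cw d \ R.ideal, x ∈ e := by
  simp [nonIdealRegion]

theorem nonIdealRegion_subset_tileRegion : R.nonIdealRegion ⊆ R.tileRegion :=
  biUnion_subset_biUnion_left sdiff_subset

theorem disjoint_closure_nonIdealRegion {e : Set R.S} (he : e ∈ R.ideal) :
    Disjoint (closure e) R.nonIdealRegion := by
  refine Disjoint.closure_left (disjoint_left.2 fun x hx hx' => ?_) R.isOpen_nonIdealRegion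
  obtain ⟨e', he', hxe'⟩ := mem_nonIdealRegion.1 hx'
  exact he'.2 (eq_of_mem_openCells (R.ideal_subset he) he'.1 hx hxe' ▸ he)

theorem exists_tile_superset_of_sub {c : Set R.S} (hc : c ∈ openCells R.sub d) :
    ∃ e ∈ openCells R.cw d, c ⊆ e := by
  obtain ⟨l, e, he, hce⟩ := R.sub_refines d c hc
  obtain ⟨y, hy⟩ := nonempty_of_mem_openCells hc
  obtain ⟨t, ht, hyt⟩ := R.pure_cw.exists_mem_closure y
  obtain ⟨z, hzc, hzt⟩ := mem_closure_iff.1 hyt c (R.pure_sub.isOpen R.finite_sub hc) hy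
  exact ⟨t, ht, eq_of_mem_openCells he ht (hce hzc) hzt ▸ hce⟩

theorem mem_tileRegion_of_map (hx : R.φ x ∈ R.tileRegion) : x ∈ R.tileRegion := by
  obtain ⟨e, he, hxe⟩ := mem_tileRegion.1 hx
  obtain ⟨k, c, hc, hxc⟩ := exists_mem_openCells (c := R.sub) (mem_univ x)
  obtain rfl : k = d := dim_eq_of_mem_openCells (R.φ_cellHomeo.image_mem k c hc) he
    (mem_image_of_mem _ hxc) hxe
  obtain ⟨t, ht, hct⟩ := exists_tile_superset_of_sub hc
  exact mem_tileRegion.2 ⟨t, ht, hct hxc⟩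

theorem mem_nonIdealRegion_of_map (hx : R.φ x ∈ R.nonIdealRegion) : x ∈ R.nonIdealRegion := by
  obtain ⟨e, he, hxe⟩ := mem_tileRegion.1 (mem_tileRegion_of_map
    (nonIdealRegion_subset_tileRegion hx))
  refine mem_nonIdealRegion.2 ⟨e, ⟨he, fun hideal => ?_⟩, hxe⟩
  obtain ⟨e', he', hφ⟩ := mem_iUnion₂.1 (R.φ_ideal (mem_biUnion hideal (subset_closure hxe)))
  exact disjoint_left.1 (disjoint_closure_nonIdealRegion he') hφ hx

theorem mem_nonIdealRegion_of_iterate {j k : ℕ} (hjk : j ≤ k)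
    (hx : R.φ^[k] x ∈ R.nonIdealRegion) : R.φ^[j] x ∈ R.nonIdealRegion := by
  induction k, hjk using Nat.le_induction with
  | base => exact hx
  | succ k _ ih =>
    rw [Function.iterate_succ_apply'] at hx
    exact ih (mem_nonIdealRegion_of_map hx)

variable (R) in
theorem exists_iterate_mem_nonIdealRegion : ∃ N, ∀ t ∈ openCells R.cw d,
    (∃ y ∈ t, R.φ^[N] y ∈ R.nonIdealRegion) → ∀ k, ∃ y ∈ t, R.φ^[k] y ∈ R.nonIdealRegion := by
  have hdepth : ∀ t : Set R.S, ∃ N, (∃ y ∈ t, R.φ^[N] y ∈ R.nonIdealRegion) →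
      ∀ k, ∃ y ∈ t, R.φ^[k] y ∈ R.nonIdealRegion := fun t => by
    by_cases h : ∀ k, ∃ y ∈ t, R.φ^[k] y ∈ R.nonIdealRegion
    · exact ⟨0, fun _ => h⟩
    · push Not at h
      obtain ⟨k, hk⟩ := h
      exact ⟨k, fun ⟨y, hy, hyk⟩ => absurd hyk (hk y hy)⟩
  choose N hN using hdepth
  have hfin : (openCells R.cw d).Finite :=
    (finite_openCells R.finite_cw).subset fun e he => ⟨d, he⟩
  obtain ⟨M, hM⟩ := (hfin.image N).bddAbove
  refine ⟨M, fun t ht ⟨y, hy, hyM⟩ => hN t ⟨y, hy, ?_⟩⟩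
  exact mem_nonIdealRegion_of_iterate (hM (mem_image_of_mem N ht)) hyM

end SubdivisionRule

section CellHomeo

variable {X : Type u} {Y : Type v} [TopologicalSpace X] [TopologicalSpace Y]
  {c : CWComplex (univ : Set X)} {c' : CWComplex (univ : Set Y)} {f : X → Y} {k l : ℕ}
  {e e' : Set X}

theorem IsCellHomeo.dim_eq_of_image_eq (hf : IsCellHomeo c c' f) (he : e ∈ openCells c k)
    (he' : e' ∈ openCells c l) (heq : f '' e = f '' e') : k = l := by
  have him := hf.image_mem k e he
  obtain ⟨y, hy⟩ := nonempty_of_mem_openCells him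
  exact dim_eq_of_mem_openCells him (hf.image_mem l e' he') hy (heq ▸ hy)

theorem IsCellHomeo.disjoint_closure_of_image_eq [T2Space X] (hf : IsCellHomeo c c' f)
    (he : e ∈ openCells c k) (he' : e' ∈ openCells c l) (hne : e ≠ e') (heq : f '' e = f '' e') :
    Disjoint (closure e) e' :=
  disjoint_left.2 fun _ hx hx' =>
    (lt_of_mem_closure_openCells he he' hne hx hx').ne' (hf.dim_eq_of_image_eq he he' heq)

end CellHomeo

namespace RComplex

open SubdivisionRule

variable {d : ℕ} {R : SubdivisionRule.{u} d} (K : RComplex.{u, v} R) {n m : ℕ}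

theorem levelMap_succ (n : ℕ) (x : K.X) : K.levelMap (n + 1) x = R.φ (K.levelMap n x) :=
  Function.iterate_succ_apply' _ _ _

theorem levelMap_add (n k : ℕ) (x : K.X) : K.levelMap (n + k) x = R.φ^[k] (K.levelMap n x) := by
  rw [add_comm]
  exact Function.iterate_add_apply _ _ _ _

theorem continuous_levelMap (n : ℕ) : Continuous (K.levelMap n) :=
  (R.φ_cellHomeo.continuous.iterate n).comp K.f_cellHomeo.continuous

variable {K} {e e' : Set K.X} {x : K.X}

theorem levelMap_succ_image_inter_preimage {c : Set R.S} (hc : c ⊆ K.levelMap n '' e) :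
    K.levelMap (n + 1) '' (e ∩ K.levelMap n ⁻¹' c) = R.φ '' c := by
  have hcomp : K.levelMap (n + 1) = R.φ ∘ K.levelMap n := funext (K.levelMap_succ n)
  rw [hcomp, image_comp, image_inter_preimage, inter_eq_right.2 hc]

theorem exists_image_mem_openCells (he : e ∈ K.cells n) :
    ∃ k, K.levelMap n '' e ∈ openCells R.cw k := by
  cases n with
  | zero => exact he.imp fun k hk => K.f_cellHomeo.image_mem k e hk
  | succ n =>
    obtain ⟨e₀, -, k, c, hc, hce, rfl⟩ := he
    exact ⟨k, levelMap_succ_image_inter_preimage hce ▸ R.φ_cellHomeo.image_mem k c hc⟩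

theorem image_eq_of_mem {τ : Set R.S} {k : ℕ} (he : e ∈ K.cells n) (hτ : τ ∈ openCells R.cw k)
    (hx : x ∈ e) (hxτ : K.levelMap n x ∈ τ) : K.levelMap n '' e = τ := by
  obtain ⟨l, hl⟩ := exists_image_mem_openCells he
  exact eq_of_mem_openCells hl hτ (mem_image_of_mem _ hx) hxτ

theorem nonempty_of_mem_cells (he : e ∈ K.cells n) : e.Nonempty := by
  obtain ⟨k, hk⟩ := exists_image_mem_openCells he
  exact (nonempty_of_mem_openCells hk).of_image

theorem isEmbedding_levelMap (he : e ∈ K.cells n) : IsEmbedding (e.domRestrict (K.levelMap n)) := by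
  induction n generalizing e with
  | zero =>
    obtain ⟨k, hk⟩ := he
    exact K.f_cellHomeo.isEmbedding k _ hk
  | succ n ih =>
    obtain ⟨e₀, he₀, k, c, hc, -, rfl⟩ := he
    have hrestrict : IsEmbedding fun x : ↥(e₀ ∩ K.levelMap n ⁻¹' c) =>
        (⟨K.levelMap n x, x.2.2⟩ : c) := by
      refine IsEmbedding.of_comp ?_ continuous_subtype_val ?_
      · exact ((K.continuous_levelMap n).comp continuous_subtype_val).subtype_mk _
      · exact (ih he₀).comp (IsEmbedding.inclusion inter_subset_left)
    convert (R.φ_cellHomeo.isEmbedding k c hc).comp hrestrict using 1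
    exact funext fun x => K.levelMap_succ n x

theorem injOn_levelMap (he : e ∈ K.cells n) : InjOn (K.levelMap n) e :=
  injOn_iff_injective.2 (isEmbedding_levelMap he).injective

theorem isPreconnected_of_mem_cells (he : e ∈ K.cells n) : IsPreconnected e := by
  obtain ⟨k, hk⟩ := exists_image_mem_openCells he
  exact isPreconnected_of_isEmbedding_domRestrict (isEmbedding_levelMap he)
    (isPreconnected_of_mem_openCells hk)

theorem exists_mem_cells (n : ℕ) (x : K.X) : ∃ e ∈ K.cells n, x ∈ e := by
  induction n with
  | zero =>
    obtain ⟨k, e, he, hx⟩ := exists_mem_openCells (c := K.cw) (mem_univ x)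
    exact ⟨e, ⟨k, he⟩, hx⟩
  | succ n ih =>
    obtain ⟨e₀, he₀, hx⟩ := ih
    obtain ⟨k, c, hc, hxc⟩ := exists_mem_openCells (c := R.sub) (mem_univ (K.levelMap n x))
    obtain ⟨l, c', hc', hcc'⟩ := R.sub_refines k c hc
    have himage : K.levelMap n '' e₀ = c' := image_eq_of_mem he₀ hc' hx (hcc' hxc)
    exact ⟨_, ⟨e₀, he₀, k, c, hc, himage ▸ hcc', rfl⟩, hx, hxc⟩

theorem eq_of_mem_cells (he : e ∈ K.cells n) (he' : e' ∈ K.cells n) (hx : x ∈ e) (hx' : x ∈ e') :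
    e = e' := by
  induction n generalizing e e' with
  | zero => exact eq_of_mem_openCells he.choose_spec he'.choose_spec hx hx'
  | succ n ih =>
    obtain ⟨e₀, he₀, k, c, hc, -, rfl⟩ := he
    obtain ⟨e₁, he₁, l, c', hc', -, rfl⟩ := he'
    rw [ih he₀ he₁ hx.1 hx'.1, eq_of_mem_openCells hc hc' hx.2 hx'.2]

theorem exists_superset_mem_cells (hnm : n ≤ m) (he : e ∈ K.cells m) :
    ∃ e₀ ∈ K.cells n, e ⊆ e₀ := by
  induction m, hnm using Nat.le_induction generalizing e with
  | base => exact ⟨e, he, subset_rfl⟩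
  | succ m _ ih =>
    obtain ⟨e₁, he₁, k, c, -, -, rfl⟩ := he
    exact (ih he₁).imp fun _ h => ⟨h.1, inter_subset_left.trans h.2⟩

theorem subset_of_mem_cells (hnm : n ≤ m) (he : e ∈ K.cells m) (he' : e' ∈ K.cells n)
    (hx : x ∈ e) (hx' : x ∈ e') : e ⊆ e' := by
  obtain ⟨e₀, he₀, hsub⟩ := exists_superset_mem_cells hnm he
  exact eq_of_mem_cells he₀ he' (hsub hx) hx' ▸ hsub

theorem finite_cells (hK : K.IsFinite) (n : ℕ) : (K.cells n).Finite := by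
  induction n with
  | zero => exact finite_openCells hK
  | succ n ih =>
    refine (Set.Finite.image2 (fun e c => e ∩ K.levelMap n ⁻¹' c) ih
      (finite_openCells R.finite_sub)).subset ?_
    rintro _ ⟨e₀, he₀, k, c, hc, -, rfl⟩
    exact ⟨e₀, he₀, c, ⟨k, hc⟩, rfl⟩

theorem disjoint_closure_of_image_eq (he : e ∈ K.cells n) (he' : e' ∈ K.cells n) (hne : e ≠ e')
    (heq : K.levelMap n '' e = K.levelMap n '' e') : Disjoint (closure e) e' := by
  induction n generalizing e e' with
  | zero =>
    obtain ⟨k, hk⟩ := he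
    obtain ⟨l, hl⟩ := he'
    exact K.f_cellHomeo.disjoint_closure_of_image_eq hk hl hne heq
  | succ n ih =>
    obtain ⟨e₀, he₀, k, c, hc, hce, rfl⟩ := he
    obtain ⟨e₁, he₁, l, c', hc', hce', rfl⟩ := he'
    rcases eq_or_ne c c' with rfl | hcc'
    · obtain ⟨y, hy⟩ := nonempty_of_mem_openCells hc
      obtain ⟨k₁, hk₁⟩ := exists_image_mem_openCells he₁
      obtain ⟨z, hz, rfl⟩ := hce hy
      exact (ih he₀ he₁ (fun h => hne (by rw [h])) (image_eq_of_mem he₀ hk₁ hz (hce' hy))).mono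
        (closure_mono inter_subset_left) inter_subset_left
    · rw [levelMap_succ_image_inter_preimage hce, levelMap_succ_image_inter_preimage hce'] at heq
      refine disjoint_left.2 fun y hy hy' => ?_
      have hyc : K.levelMap n y ∈ closure c :=
        map_mem_closure (K.continuous_levelMap n) hy fun z hz => hz.2
      exact disjoint_left.1 (R.φ_cellHomeo.disjoint_closure_of_image_eq hc hc' hcc' heq) hyc hy'.2

theorem mem_cells_of_isPreconnected (hK : K.IsFinite) {A : Set K.X} (hA : IsPreconnected A) {k : ℕ}
    (hτ : K.levelMap n '' A ∈ openCells R.cw k) : A ∈ K.cells n := by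
  let Q : Set (Set K.X) := {b ∈ K.cells n | K.levelMap n '' b = K.levelMap n '' A}
  have hQ : ∀ z ∈ A, ∃ b ∈ Q, z ∈ b := fun z hz => by
    obtain ⟨b, hb, hzb⟩ := exists_mem_cells n z
    exact ⟨b, ⟨hb, image_eq_of_mem hb hτ hzb (mem_image_of_mem _ hz)⟩, hzb⟩
  obtain ⟨z, hz⟩ := (nonempty_of_mem_openCells hτ).of_image
  obtain ⟨b, hb, hzb⟩ := hQ z hz
  have hAb : A ⊆ b := subset_of_isPreconnected_of_disjoint_closure
    ((finite_cells hK n).subset fun _ h => h.1)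
    (fun b hb b' hb' hne => disjoint_closure_of_image_eq hb.1 hb'.1 hne (hb.2.trans hb'.2.symm))
    hA hQ hb ⟨z, hz, hzb⟩
  have hbA : b ⊆ A := fun w hw => by
    obtain ⟨w', hw', hww'⟩ := hb.2.le (mem_image_of_mem _ hw)
    exact injOn_levelMap hb.1 (hAb hw') hw hww' ▸ hw'
  exact hAb.antisymm hbA ▸ hb.1

theorem dense_tiles (n : ℕ) : Dense (K.levelMap n ⁻¹' R.tileRegion) := by
  induction n with
  | zero =>
    refine K.pure_cw.dense.mono (iUnion₂_subset fun e he x hx => ?_)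
    exact mem_tileRegion.2 ⟨_, K.f_cellHomeo.image_mem d e he, mem_image_of_mem _ hx⟩
  | succ n ih =>
    refine dense_closure.1 (ih.mono fun x hx => ?_)
    obtain ⟨e, he, hxe⟩ := exists_mem_cells n x
    obtain ⟨t, ht, hxt⟩ := mem_tileRegion.1 hx
    have hopen : IsOpen (K.levelMap n '' e) :=
      image_eq_of_mem he ht hxe hxt ▸ R.pure_cw.isOpen R.finite_cw ht
    refine closure_mono (fun y hy => ?_) (subset_closure_inter_preimage_of_dense
      (isEmbedding_levelMap he) hopen R.pure_sub.dense hxe)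
    obtain ⟨c, hc, hyc⟩ := mem_iUnion₂.1 hy.2
    exact mem_tileRegion.2 ⟨_, R.φ_cellHomeo.image_mem d c hc, K.levelMap_succ n y ▸
      mem_image_of_mem _ hyc⟩

theorem finite_fiber (hK : K.IsFinite) (n : ℕ) (y : R.S) : (K.levelMap n ⁻¹' {y}).Finite := by
  have hcover : K.levelMap n ⁻¹' {y} ⊆ ⋃ e ∈ K.cells n, e ∩ K.levelMap n ⁻¹' {y} := fun x hx => by
    obtain ⟨e, he, hxe⟩ := exists_mem_cells n x
    exact mem_biUnion he ⟨hxe, hx⟩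
  refine ((finite_cells hK n).biUnion fun e he => Set.Subsingleton.finite ?_).subset hcover
  exact fun a ha b hb => injOn_levelMap he ha.1 hb.1 (ha.2.trans hb.2.symm)

theorem exists_tile_mem_closure (hK : K.IsFinite) (n : ℕ) (x : K.X) :
    ∃ e ∈ K.cells n, K.levelMap n '' e ∈ openCells R.cw d ∧ x ∈ closure e := by
  let T : Set (Set K.X) := {e ∈ K.cells n | K.levelMap n '' e ∈ openCells R.cw d}
  have hclosed : IsClosed (⋃ e ∈ T, closure e) :=
    ((finite_cells hK n).subset fun e he => he.1).isClosed_biUnion fun _ _ => isClosed_closure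
  have htiles : K.levelMap n ⁻¹' R.tileRegion ⊆ ⋃ e ∈ T, closure e := fun y hy => by
    obtain ⟨e, he, hye⟩ := exists_mem_cells n y
    obtain ⟨t, ht, hyt⟩ := mem_tileRegion.1 hy
    exact mem_biUnion (⟨he, image_eq_of_mem he ht hye hyt ▸ ht⟩ : e ∈ T) (subset_closure hye)
  obtain ⟨e, he, hx⟩ := mem_iUnion₂.1 (closure_minimal htiles hclosed (dense_tiles n x))
  exact ⟨e, he.1, he.2, hx⟩

/-- The chart is a lift of the characteristic map of the type of `t`. It sends faces to cells of
`R^n(X)` because the image of a face is connected and lies over a single open cell of `S_R`. -/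
theorem exists_polyhedral_chart (hK : K.IsFinite) {t : Set K.X} (ht : t ∈ K.cells n)
    (htd : K.levelMap n '' t ∈ openCells R.cw d) :
    ∃ (s : CWComplex (closedBall (0 : Fin d → ℝ) 1)) (g : (Fin d → ℝ) → K.X),
      ContinuousOn g (closedBall 0 1) ∧ g '' closedBall 0 1 = closure t ∧
      (∀ k, ∀ a ∈ openCells s k, g '' a ∈ K.cells n) ∧
      ∀ k l, ∀ a ∈ openCells s k, ∀ b ∈ openCells s l, ∀ z ∈ closure a, z ∈ b → b ⊆ closure a := by
  have : CompactSpace K.X := compactSpace_of_finite_cells hK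
  obtain ⟨i, hi⟩ := htd
  obtain ⟨s, hball, -, hsc, hsi⟩ := R.polyhedral i
  have hD : closure (ball (0 : Fin d → ℝ) 1) = closedBall 0 1 := closure_ball _ one_ne_zero
  obtain ⟨g, hg, hgt, hFg⟩ := exists_continuousOn_closure_lift (K.continuous_levelMap n)
    (fun y => isTotallyDisconnected_of_finite (finite_fiber hK n y)) (isEmbedding_levelMap ht)
    (convex_ball (0 : Fin d → ℝ) 1) (nonempty_ball.2 one_pos) (hD.symm ▸ R.cw.continuousOn d i)
    (mapsTo_iff_image_subset.2 hi.ge)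
  rw [hD] at hg hFg
  have hcells : ∀ k, ∀ a ∈ openCells s k, g '' a ∈ K.cells n := fun k a ha => by
    have haD : a ⊆ closedBall 0 1 := subset_of_mem_openCells ha
    have himage : K.levelMap n '' (g '' a) = R.cw.map d i '' a := by
      rw [← image_comp]
      exact image_congr fun z hz => hFg (haD hz)
    exact mem_cells_of_isPreconnected hK
      ((isPreconnected_of_mem_openCells ha).image _ (hg.mono haD)) (himage ▸ (hsc k a ha).1)
  refine ⟨s, g, hg, ?_, hcells, fun k l a ha b hb z hza hzb =>
    subset_closure_of_inter_eq_closure hsi ha hb hza hzb⟩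
  have hg0 := mem_ball_self (x := (0 : Fin d → ℝ)) one_pos
  rw [← eq_of_mem_cells (hcells d _ hball) ht (mem_image_of_mem g hg0) (hgt hg0), ← hD]
  exact image_closure_of_isCompact (hD.symm ▸ isCompact_closedBall _ _) (hD.symm ▸ hg)

theorem subset_closure_of_mem (hK : K.IsFinite) (he : e ∈ K.cells n) (he' : e' ∈ K.cells n)
    (hx : x ∈ closure e) (hx' : x ∈ e') : e' ⊆ closure e := by
  obtain ⟨y, hy⟩ := nonempty_of_mem_cells he
  obtain ⟨t, ht, htd, hyt⟩ := exists_tile_mem_closure hK n y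
  obtain ⟨s, g, hg, hgt, hcells, hfaces⟩ := exists_polyhedral_chart hK ht htd
  have hclosure : ∀ k, ∀ a ∈ openCells s k, closure a ⊆ closedBall 0 1 := fun k a ha =>
    closure_minimal (subset_of_mem_openCells ha) isClosed_closedBall
  have hface : ∀ z ∈ closedBall (0 : Fin d → ℝ) 1, ∀ b ∈ K.cells n, g z ∈ b →
      ∃ k, ∃ a ∈ openCells s k, z ∈ a ∧ g '' a = b := fun z hz b hb hzb => by
    obtain ⟨k, a, ha, hza⟩ := exists_mem_openCells (c := s) hz
    exact ⟨k, a, ha, hza, eq_of_mem_cells (hcells k a ha) hb (mem_image_of_mem g hza) hzb⟩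
  obtain ⟨z, hz, rfl⟩ := hgt.ge hyt
  obtain ⟨k, a, ha, -, rfl⟩ := hface z hz e he hy
  rw [← image_closure_of_isCompact ((isCompact_closedBall _ _).of_isClosed_subset isClosed_closure
    (hclosure k a ha)) (hg.mono (hclosure k a ha))] at hx ⊢
  obtain ⟨w, hw, rfl⟩ := hx
  obtain ⟨l, b, hb, hwb, rfl⟩ := hface w (hclosure k a ha hw) e' he' hx'
  exact image_mono (hfaces k l a ha b hb w hw hwb)

end RComplex

namespace RComplex

open SubdivisionRule

variable {d : ℕ} {R : SubdivisionRule.{u} d} {K : RComplex.{u, v} R} {n m : ℕ} {x y : K.X}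

section LimitSet

variable {e : Set K.X}

theorem mem_nonIdealTiles_of_mem (he : e ∈ K.cells n) (hx : x ∈ e)
    (hxV : K.levelMap n x ∈ R.nonIdealRegion) : e ∈ K.nonIdealTiles n := by
  obtain ⟨t, ht, hxt⟩ := mem_nonIdealRegion.1 hxV
  have himage := image_eq_of_mem he ht.1 hx hxt
  exact ⟨he, himage ▸ ht⟩

theorem biUnion_nonIdealTiles (n : ℕ) :
    ⋃ e ∈ K.nonIdealTiles n, e = K.levelMap n ⁻¹' R.nonIdealRegion := by
  refine Subset.antisymm (iUnion₂_subset fun e he x hx => ?_) fun x hx => ?_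
  · exact mem_nonIdealRegion.2 ⟨_, he.2, mem_image_of_mem _ hx⟩
  · obtain ⟨e, he, hxe⟩ := exists_mem_cells n x
    exact mem_biUnion (mem_nonIdealTiles_of_mem he hxe hx) hxe

theorem limitLevel_eq_closure (hK : K.IsFinite) (n : ℕ) :
    K.limitLevel n = closure (K.levelMap n ⁻¹' R.nonIdealRegion) := by
  have hfin : (K.nonIdealTiles n).Finite := (finite_cells hK n).subset fun _ he => he.1
  rw [← biUnion_nonIdealTiles, hfin.closure_biUnion, limitLevel]

theorem isClosed_limitLevel (hK : K.IsFinite) (n : ℕ) : IsClosed (K.limitLevel n) :=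
  limitLevel_eq_closure hK n ▸ isClosed_closure

theorem limitLevel_antitone (hK : K.IsFinite) : Antitone K.limitLevel :=
  antitone_nat_of_succ_le fun n => by
    rw [limitLevel_eq_closure hK, limitLevel_eq_closure hK]
    refine closure_mono fun x hx => mem_nonIdealRegion_of_map ?_
    rwa [← levelMap_succ]

theorem compl_interior_idealTiles (hK : K.IsFinite) (n : ℕ) :
    (interior (⋃ e ∈ K.idealTiles n, closure e))ᶜ = K.limitLevel n := by
  rw [← closure_compl]
  refine Subset.antisymm (closure_minimal (fun x hx => ?_) (isClosed_limitLevel hK n)) ?_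
  · obtain ⟨e, he, hed, hxe⟩ := exists_tile_mem_closure hK n x
    exact mem_biUnion ⟨he, hed, fun hideal => hx (mem_biUnion ⟨he, hideal⟩ hxe)⟩ hxe
  · rw [limitLevel_eq_closure hK]
    refine closure_mono fun x hx hx' => ?_
    obtain ⟨e, he, hxe⟩ := mem_iUnion₂.1 hx'
    exact disjoint_left.1 (disjoint_closure_nonIdealRegion he.2)
      (map_mem_closure (K.continuous_levelMap n) hxe fun _ => mem_image_of_mem _) hx

theorem limitSet_eq_iInter (hK : K.IsFinite) : K.limitSet = ⋂ n, K.limitLevel n := by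
  rw [limitSet, idealSet, compl_iUnion]
  exact iInter_congr (compl_interior_idealTiles hK)

theorem limitSet_subset (hK : K.IsFinite) (n : ℕ) : K.limitSet ⊆ K.limitLevel n :=
  limitSet_eq_iInter hK ▸ iInter_subset _ n

theorem nonempty_inter_limitSet (hK : K.IsFinite) {C : Set K.X} (hC : IsClosed C)
    (h : ∀ n, (C ∩ K.limitLevel n).Nonempty) : (C ∩ K.limitSet).Nonempty := by
  have : CompactSpace K.X := compactSpace_of_finite_cells hK
  have hclosed : ∀ n, IsClosed (C ∩ K.limitLevel n) := fun n => hC.inter (isClosed_limitLevel hK n)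
  rw [limitSet_eq_iInter hK, inter_iInter]
  exact IsCompact.nonempty_iInter_of_sequence_nonempty_isCompact_isClosed _
    (fun n => inter_subset_inter_right C (limitLevel_antitone hK n.le_succ)) h
    (hclosed 0).isCompact hclosed

theorem subset_limitLevel (hK : K.IsFinite) (he : e ∈ K.cells n) (hx : x ∈ e)
    (hxL : x ∈ K.limitLevel n) : e ⊆ K.limitLevel n := by
  obtain ⟨t, ht, hxt⟩ := mem_iUnion₂.1 hxL
  exact (subset_closure_of_mem hK ht.1 he hxt hx).trans (subset_biUnion_of_mem (u := closure) ht)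

theorem exists_depth_nonempty_closure_inter_limitSet (hK : K.IsFinite) :
    ∃ N, ∀ n, ∀ e ∈ K.cells n, ∀ x ∈ e, K.levelMap (n + N) x ∈ R.nonIdealRegion →
      (closure e ∩ K.limitSet).Nonempty := by
  obtain ⟨N, hN⟩ := R.exists_iterate_mem_nonIdealRegion
  refine ⟨N, fun n e he x hx hxV => nonempty_inter_limitSet hK isClosed_closure fun k => ?_⟩
  rw [levelMap_add] at hxV
  obtain ⟨-, htile, -⟩ :=
    mem_nonIdealTiles_of_mem he hx
      (mem_nonIdealRegion_of_iterate (x := K.levelMap n x) N.zero_le hxV)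
  obtain ⟨_, ⟨y, hy, rfl⟩, hyV⟩ := hN _ htile ⟨_, mem_image_of_mem _ hx, hxV⟩ k
  rw [← levelMap_add] at hyV
  refine ⟨y, subset_closure hy, limitLevel_antitone hK (Nat.le_add_left k n) ?_⟩
  exact limitLevel_eq_closure hK _ ▸ subset_closure hyV

end LimitSet

section LevelGraph

variable {a b : K.LevelVertex n}

theorem exists_vertex (hK : K.IsFinite) (hx : x ∈ K.limitLevel n) :
    ∃ a : K.LevelVertex n, x ∈ a.1 := by
  obtain ⟨e, he, hxe⟩ := exists_mem_cells n x
  exact ⟨⟨e, he, subset_limitLevel hK he hxe hx⟩, hxe⟩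

theorem nonempty_vertex (a : K.LevelVertex n) : a.1.Nonempty := nonempty_of_mem_cells a.2.1

theorem eq_of_mem_vertex (ha : x ∈ a.1) (hb : x ∈ b.1) : a = b :=
  Subtype.ext (eq_of_mem_cells a.2.1 b.2.1 ha hb)

theorem finite_levelVertex (hK : K.IsFinite) (n : ℕ) : Finite (K.LevelVertex n) :=
  ((finite_cells hK n).subset (sep_subset _ _)).to_subtype

theorem isPreconnected_closure_vertex (a : K.LevelVertex n) : IsPreconnected (closure a.1) :=
  (isPreconnected_of_mem_cells a.2.1).closure

theorem closure_vertex_subset (hK : K.IsFinite) (a : K.LevelVertex n) :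
    closure a.1 ⊆ K.limitLevel n :=
  closure_minimal a.2.2 (isClosed_limitLevel hK n)

theorem levelGraph_adj : (K.levelGraph n).Adj a b ↔
    a ≠ b ∧ (closure a.1 ⊆ closure b.1 ∨ closure b.1 ⊆ closure a.1) :=
  SimpleGraph.fromRel_adj _ _ _

theorem levelGraph_edist_le_one (hK : K.IsFinite) (ha : x ∈ a.1) (hb : x ∈ closure b.1) :
    (K.levelGraph n).edist a b ≤ 1 := by
  rw [SimpleGraph.edist_le_one_iff_adj_or_eq, or_iff_not_imp_right]
  exact fun hne => levelGraph_adj.2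
    ⟨hne, Or.inl (closure_minimal (subset_closure_of_mem hK b.2.1 a.2.1 hb ha) isClosed_closure)⟩

theorem reachable_of_mem_closure (hK : K.IsFinite) (ha : x ∈ a.1) (hb : x ∈ closure b.1) :
    (K.levelGraph n).Reachable a b :=
  SimpleGraph.reachable_of_edist_ne_top
    ((levelGraph_edist_le_one hK ha hb).trans_lt ENat.one_lt_top).ne

theorem reachable_of_isPreconnected (hK : K.IsFinite) {s : Set K.X} (hs : IsPreconnected s)
    (hsL : s ⊆ K.limitLevel n) (hx : x ∈ s) (hy : y ∈ s) (hxa : x ∈ a.1) (hyb : y ∈ b.1) :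
    (K.levelGraph n).Reachable a b := by
  have := finite_levelVertex hK n
  by_contra hab
  let U (P : K.LevelVertex n → Prop) : Set K.X := ⋃ c ∈ {c | P c}, closure c.1
  have hU : ∀ P, IsClosed (U P) := fun P =>
    (toFinite {c | P c}).isClosed_biUnion fun _ _ => isClosed_closure
  have hmem : ∀ {P : K.LevelVertex n → Prop} {c z}, P c → z ∈ c.1 → z ∈ U P := fun hPc hz =>
    mem_biUnion hPc (subset_closure hz)
  obtain ⟨z, hz, hz₁, hz₂⟩ := isPreconnected_closed_iff.1 hs _ _
    (hU fun c => (K.levelGraph n).Reachable a c) (hU fun c => ¬ (K.levelGraph n).Reachable a c)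
    (fun z hz => by
      obtain ⟨c, hc⟩ := exists_vertex hK (hsL hz)
      exact (em ((K.levelGraph n).Reachable a c)).imp (hmem · hc) (hmem · hc))
    ⟨x, hx, hmem (SimpleGraph.Reachable.refl a) hxa⟩ ⟨y, hy, hmem hab hyb⟩
  obtain ⟨c₁, hc₁, hzc₁⟩ := mem_iUnion₂.1 hz₁
  obtain ⟨c₂, hc₂, hzc₂⟩ := mem_iUnion₂.1 hz₂
  obtain ⟨c, hc⟩ := exists_vertex hK (hsL hz)
  exact hc₂ (hc₁.trans ((reachable_of_mem_closure hK hc hzc₁).symm.trans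
    (reachable_of_mem_closure hK hc hzc₂)))

theorem connectedComponentIn_eq_of_closure_subset (hK : K.IsFinite)
    (h : closure a.1 ⊆ closure b.1) (hx : x ∈ a.1) (hy : y ∈ b.1) :
    connectedComponentIn (K.limitLevel n) x = connectedComponentIn (K.limitLevel n) y :=
  connectedComponentIn_eq <| (isPreconnected_closure_vertex b).subset_connectedComponentIn
    (h (subset_closure hx)) (closure_vertex_subset hK b) (subset_closure hy)

theorem connectedComponentIn_eq_of_reachable (hK : K.IsFinite)
    (h : (K.levelGraph n).Reachable a b) (hx : x ∈ a.1) (hy : y ∈ b.1) :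
    connectedComponentIn (K.limitLevel n) x = connectedComponentIn (K.limitLevel n) y := by
  obtain ⟨p⟩ := h
  induction p generalizing x with
  | nil => exact connectedComponentIn_eq_of_closure_subset hK subset_rfl hx hy
  | @cons _ v _ hadj _ ih =>
    obtain ⟨z, hz⟩ := nonempty_vertex v
    rw [← ih hz hy]
    rcases (levelGraph_adj.1 hadj).2 with h | h
    · exact connectedComponentIn_eq_of_closure_subset hK h hx hz
    · exact (connectedComponentIn_eq_of_closure_subset hK h hz hx).symm

theorem sameComponent_iff_reachable (hK : K.IsFinite) :
    K.SameComponent n a b ↔ (K.levelGraph n).Reachable a b := by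
  obtain ⟨y, hy⟩ := nonempty_vertex a
  obtain ⟨z, hz⟩ := nonempty_vertex b
  constructor
  · rintro ⟨x, -, ha, hb⟩
    exact reachable_of_isPreconnected hK isPreconnected_connectedComponentIn
      (connectedComponentIn_subset _ _) (ha hy) (hb hz) hy hz
  · intro h
    refine ⟨y, a.2.2 hy,
      (isPreconnected_of_mem_cells a.2.1).subset_connectedComponentIn hy a.2.2, ?_⟩
    rw [connectedComponentIn_eq_of_reachable hK h hy hz]
    exact (isPreconnected_of_mem_cells b.2.1).subset_connectedComponentIn hz b.2.2

end LevelGraph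

section LimitCell

variable (hK : K.IsFinite) (p q : K.limitSet)

/-- The cell of `Γ_n` which contains the limit point `p`. -/
noncomputable def limitCell (n : ℕ) : K.LevelVertex n :=
  (exists_vertex hK (limitSet_subset hK n p.2)).choose

theorem mem_limitCell (n : ℕ) : p.1 ∈ (limitCell hK p n).1 :=
  (exists_vertex hK (limitSet_subset hK n p.2)).choose_spec

theorem limitCell_subset (hnm : n ≤ m) : (limitCell hK p m).1 ⊆ (limitCell hK p n).1 :=
  subset_of_mem_cells hnm (limitCell hK p m).2.1 (limitCell hK p n).2.1 (mem_limitCell hK p m)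
    (mem_limitCell hK p n)

theorem exists_limitCell_eq {a : K.LevelVertex n} (ha : (a.1 ∩ K.limitSet).Nonempty) :
    ∃ p, limitCell hK p n = a := by
  obtain ⟨x, hxa, hx⟩ := ha
  exact ⟨⟨x, hx⟩, eq_of_mem_vertex (mem_limitCell hK _ n) hxa⟩

include hK in
theorem isPreconnected_iInter_connectedComponentIn :
    IsPreconnected (⋂ n, connectedComponentIn (K.limitLevel n) p) := by
  have : CompactSpace K.X := compactSpace_of_finite_cells hK
  have hanti : Antitone fun n => connectedComponentIn (K.limitLevel n) (p : K.X) := fun i j hij =>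
    connectedComponentIn_mono _ (limitLevel_antitone hK hij)
  refine isPreconnected_iInter_of_directed (directed_of_isDirected_le hanti) (fun n => ?_)
    fun n => isPreconnected_connectedComponentIn
  exact isClosed_of_closure_subset (isPreconnected_connectedComponentIn.closure
    |>.subset_connectedComponentIn
      (subset_closure (mem_connectedComponentIn (limitSet_subset hK n p.2)))
      (closure_minimal (connectedComponentIn_subset _ _) (isClosed_limitLevel hK n)))

theorem connectedComponents_eq_iff : (p : ConnectedComponents K.limitSet) = q ↔
    ∀ n, (K.levelGraph n).Reachable (limitCell hK p n) (limitCell hK q n) := by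
  rw [ConnectedComponents.coe_eq_coe]
  constructor
  · intro h n
    have hq : q ∈ connectedComponent p := h ▸ mem_connectedComponent
    refine reachable_of_isPreconnected hK (isPreconnected_connectedComponent.image Subtype.val
      continuous_subtype_val.continuousOn (s := connectedComponent p))
      (image_subset_iff.2 fun z _ => limitSet_subset hK n z.2)
      (mem_image_of_mem _ mem_connectedComponent) (mem_image_of_mem _ hq)
      (mem_limitCell hK p n) (mem_limitCell hK q n)
  · intro h
    have hp : (p : K.X) ∈ ⋂ n, connectedComponentIn (K.limitLevel n) p := mem_iInter.2 fun n =>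
      mem_connectedComponentIn (limitSet_subset hK n p.2)
    have hq : (q : K.X) ∈ ⋂ n, connectedComponentIn (K.limitLevel n) p := mem_iInter.2 fun n => by
      rw [connectedComponentIn_eq_of_reachable hK (h n) (mem_limitCell hK p n)
        (mem_limitCell hK q n)]
      exact mem_connectedComponentIn (limitSet_subset hK n q.2)
    have hsub : (⋂ n, connectedComponentIn (K.limitLevel n) p) ⊆ K.limitSet :=
      (iInter_mono fun n => connectedComponentIn_subset _ _).trans (limitSet_eq_iInter hK).ge
    have hpre : IsPreconnected
        ((↑) ⁻¹' (⋂ n, connectedComponentIn (K.limitLevel n) p) : Set K.limitSet) := by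
      rw [← IsInducing.subtypeVal.isPreconnected_image, Subtype.image_preimage_coe,
        inter_eq_right.2 hsub]
      exact isPreconnected_iInter_connectedComponentIn hK p
    exact connectedComponent_eq (hpre.subset_connectedComponent hp hq)

theorem exists_edist_limitCell_le :
    ∃ N, ∀ (n : ℕ) (v : K.LevelVertex (n + N)), ∃ (a : K.LevelVertex n) (p : K.limitSet),
      v.1 ⊆ a.1 ∧ (K.levelGraph n).edist a (limitCell hK p n) ≤ 2 := by
  obtain ⟨N, hN⟩ := exists_depth_nonempty_closure_inter_limitSet hK
  refine ⟨N, fun n v => ?_⟩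
  obtain ⟨x, hx⟩ := nonempty_vertex v
  obtain ⟨t, ht, hxt⟩ := mem_iUnion₂.1 (v.2.2 hx)
  obtain ⟨t₀, ht₀, htt₀⟩ := exists_superset_mem_cells (Nat.le_add_right n N) ht.1
  obtain ⟨y, hy⟩ := nonempty_of_mem_cells ht.1
  have hyV : K.levelMap (n + N) y ∈ R.nonIdealRegion :=
    mem_nonIdealRegion.2 ⟨_, ht.2, mem_image_of_mem _ hy⟩
  obtain ⟨p, hpt₀, hp⟩ := hN n t₀ ht₀ y (htt₀ hy) hyV
  have hyL : y ∈ K.limitLevel n := limitLevel_antitone hK (Nat.le_add_right n N)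
    (limitLevel_eq_closure hK _ ▸ subset_closure hyV)
  let c : K.LevelVertex n := ⟨t₀, ht₀, subset_limitLevel hK ht₀ (htt₀ hy) hyL⟩
  obtain ⟨a, ha⟩ := exists_vertex hK (limitLevel_antitone hK (Nat.le_add_right n N) (v.2.2 hx))
  refine ⟨a, ⟨p, hp⟩, subset_of_mem_cells (Nat.le_add_right n N) v.2.1 a.2.1 hx ha, ?_⟩
  have hac : (K.levelGraph n).edist a c ≤ 1 :=
    levelGraph_edist_le_one hK ha (closure_mono htt₀ hxt)
  have hpc : (K.levelGraph n).edist (limitCell hK ⟨p, hp⟩ n) c ≤ 1 :=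
    levelGraph_edist_le_one hK (mem_limitCell hK ⟨p, hp⟩ n) hpt₀
  calc (K.levelGraph n).edist a (limitCell hK ⟨p, hp⟩ n)
      ≤ (K.levelGraph n).edist a c + (K.levelGraph n).edist c (limitCell hK ⟨p, hp⟩ n) :=
        SimpleGraph.edist_triangle
    _ ≤ 1 + 1 := add_le_add hac (SimpleGraph.edist_comm.trans_le hpc)
    _ = 2 := one_add_one_eq_two

end LimitCell

end RComplex

namespace RComplex

variable {d : ℕ} {R : SubdivisionRule.{u} d} {K : RComplex.{u, v} R} {n m : ℕ}

section HistoryGraph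

variable {a b : K.LevelVertex n} {x y z : K.HistoryVertex}

/-- The distance of a vertex of the history graph from the origin. It exceeds the level of a cell by
one. -/
def depth : K.HistoryVertex → ℕ
  | none => 0
  | some v => v.1 + 1

@[simp]
theorem depth_none : depth (none : K.HistoryVertex) = 0 := rfl

@[simp]
theorem depth_some (a : K.LevelVertex n) : depth (some ⟨n, a⟩ : K.HistoryVertex) = n + 1 := rfl

/-- The vertex of the history graph is a cell of some level `m ≥ n`, contained in the cell `a` of
`Γ_n`. -/
def IsAncestor (a : K.LevelVertex n) : K.HistoryVertex → Prop
  | none => False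
  | some v => n ≤ v.1 ∧ v.2.1 ⊆ a.1

theorem exists_isAncestor (hK : K.IsFinite) (hx : n < depth x) :
    ∃ a : K.LevelVertex n, IsAncestor a x := by
  rcases x with _ | ⟨m, b⟩
  · exact (Nat.not_lt_zero n hx).elim
  · have hnm : n ≤ m := Nat.lt_succ_iff.1 hx
    obtain ⟨z, hz⟩ := nonempty_vertex b
    obtain ⟨a, ha⟩ := exists_vertex hK (limitLevel_antitone hK hnm (b.2.2 hz))
    exact ⟨a, hnm, subset_of_mem_cells hnm b.2.1 a.2.1 hz ha⟩

theorem eq_of_isAncestor (ha : IsAncestor a x) (hb : IsAncestor b x) : a = b := by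
  rcases x with _ | ⟨m, c⟩
  · exact ha.elim
  · obtain ⟨z, hz⟩ := nonempty_vertex c
    exact eq_of_mem_vertex (ha.2 hz) (hb.2 hz)

theorem historyGraph_adj :
    K.historyGraph.Adj x y ↔ x ≠ y ∧ (K.HistoryEdge x y ∨ K.HistoryEdge y x) :=
  SimpleGraph.fromRel_adj _ _ _

/-- The inclusion of `Γ_n` into the history graph. -/
def levelHom (n : ℕ) : K.levelGraph n →g K.historyGraph where
  toFun a := some ⟨n, a⟩
  map_rel' {a b} h := historyGraph_adj.2
    ⟨fun heq => h.ne (by simpa using heq), Or.inl (HistoryEdge.horizontal n a b h)⟩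

theorem historyGraph_edist_le (a b : K.LevelVertex n) :
    K.historyGraph.edist (some ⟨n, a⟩) (some ⟨n, b⟩) ≤ (K.levelGraph n).edist a b :=
  le_iInf fun p => (SimpleGraph.edist_le (p.map (levelHom n))).trans_eq
    (by rw [SimpleGraph.Walk.length_map])

theorem exists_vertical_walk (hK : K.IsFinite) {x : K.HistoryVertex} (hax : IsAncestor a x) :
    ∃ p : K.historyGraph.Walk (some ⟨n, a⟩) x, p.length + n + 1 = depth x ∧
      ∀ z ∈ p.support, n < depth z := by
  rcases x with _ | ⟨m, b⟩
  · exact hax.elim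
  obtain ⟨hnm : n ≤ m, hba : b.1 ⊆ a.1⟩ := hax
  obtain ⟨y, hy⟩ := nonempty_vertex b
  induction m, hnm using Nat.le_induction with
  | base =>
    obtain rfl := eq_of_mem_vertex hy (hba hy)
    exact ⟨SimpleGraph.Walk.nil, by simp, by simp⟩
  | succ m hnm ih =>
    obtain ⟨c, hc⟩ := exists_vertex hK (limitLevel_antitone hK m.le_succ (b.2.2 hy))
    have hbc : b.1 ⊆ c.1 := subset_of_mem_cells m.le_succ b.2.1 c.2.1 hy hc
    obtain ⟨p, hlength, hsupport⟩ := ih c (subset_of_mem_cells hnm c.2.1 a.2.1 hc (hba hy)) hc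
    have hadj : K.historyGraph.Adj (some ⟨m, c⟩) (some ⟨m + 1, b⟩) :=
      historyGraph_adj.2 ⟨by simp, Or.inl (HistoryEdge.vertical m c b hbc)⟩
    refine ⟨p.concat hadj, ?_, fun z hz => ?_⟩
    · rw [SimpleGraph.Walk.length_concat, depth_some] at *
      omega
    rw [SimpleGraph.Walk.support_concat, List.mem_append, List.mem_singleton] at hz
    rcases hz with hz | rfl
    · exact hsupport z hz
    · exact Nat.lt_succ_of_le (hnm.trans m.le_succ)

theorem dist_add_le_depth (hK : K.IsFinite) (hax : IsAncestor a x) :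
    K.historyGraph.dist (some ⟨n, a⟩) x + n + 1 ≤ depth x := by
  obtain ⟨p, hp, -⟩ := exists_vertical_walk hK hax
  have := SimpleGraph.dist_le p
  omega

theorem exists_walk_origin (hK : K.IsFinite) (x : K.HistoryVertex) :
    ∃ p : K.historyGraph.Walk none x, p.length = depth x := by
  rcases x with _ | ⟨n, b⟩
  · exact ⟨SimpleGraph.Walk.nil, rfl⟩
  · obtain ⟨a, ha⟩ := exists_isAncestor hK (x := some ⟨n, b⟩) n.succ_pos
    obtain ⟨p, hp, -⟩ := exists_vertical_walk hK ha
    have hadj : K.historyGraph.Adj none (some ⟨0, a⟩) :=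
      historyGraph_adj.2 ⟨by simp, Or.inl (HistoryEdge.origin a)⟩
    exact ⟨SimpleGraph.Walk.cons hadj p, hp⟩

theorem historyGraph_connected (hK : K.IsFinite) : K.historyGraph.Connected := by
  have h : ∀ x, K.historyGraph.Reachable none x := fun x => ⟨(exists_walk_origin hK x).choose⟩
  exact { preconnected := fun x y => (h x).symm.trans (h y), nonempty := ⟨none⟩ }

theorem depth_le_of_adj (h : K.historyGraph.Adj x y) : depth y ≤ depth x + 1 := by
  rcases (historyGraph_adj.1 h).2 with h | h <;> cases h <;> simp [depth]

theorem depth_le_add_length (p : K.historyGraph.Walk x y) : depth y ≤ depth x + p.length := by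
  induction p with
  | nil => exact le_rfl
  | cons h p ih =>
    have := depth_le_of_adj h
    rw [SimpleGraph.Walk.length_cons]
    omega

theorem depth_le_add_dist (hK : K.IsFinite) (x y : K.HistoryVertex) :
    depth y ≤ depth x + K.historyGraph.dist x y := by
  obtain ⟨p, hp⟩ := (historyGraph_connected hK).exists_walk_length_eq_dist x y
  exact hp ▸ depth_le_add_length p

theorem dist_origin (hK : K.IsFinite) (x : K.HistoryVertex) :
    K.historyGraph.dist none x = depth x := by
  obtain ⟨p, hp⟩ := exists_walk_origin hK x
  have hle := depth_le_add_dist hK none x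
  rw [depth_none, zero_add] at hle
  exact le_antisymm (hp ▸ SimpleGraph.dist_le p) hle

theorem dist_le_depth_add_depth (hK : K.IsFinite) (x y : K.HistoryVertex) :
    K.historyGraph.dist x y ≤ depth x + depth y := by
  rw [← dist_origin hK x, ← dist_origin hK y, SimpleGraph.dist_comm (u := none) (v := x)]
  exact (historyGraph_connected hK).dist_triangle

theorem levelGraph_edist_le_one_of_historyEdge (hK : K.IsFinite) (h : K.HistoryEdge x y)
    (ha : IsAncestor a x) (hb : IsAncestor b y) : (K.levelGraph n).edist a b ≤ 1 := by
  cases h with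
  | origin c => exact ha.elim
  | horizontal m c c' h =>
    rcases (levelGraph_adj.1 h).2 with h | h
    · obtain ⟨z, hz⟩ := nonempty_vertex c
      exact levelGraph_edist_le_one hK (ha.2 hz) (closure_mono hb.2 (h (subset_closure hz)))
    · obtain ⟨z, hz⟩ := nonempty_vertex c'
      rw [SimpleGraph.edist_comm]
      exact levelGraph_edist_le_one hK (hb.2 hz) (closure_mono ha.2 (h (subset_closure hz)))
  | vertical m c c' h =>
    obtain ⟨z, hz⟩ := nonempty_vertex c'
    exact levelGraph_edist_le_one hK (ha.2 (h hz)) (subset_closure (hb.2 hz))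

theorem levelGraph_edist_le_length (hK : K.IsFinite) (p : K.historyGraph.Walk x y)
    (hp : ∀ z ∈ p.support, n < depth z) (ha : IsAncestor a x) (hb : IsAncestor b y) :
    (K.levelGraph n).edist a b ≤ p.length := by
  induction p generalizing a with
  | nil => simp [eq_of_isAncestor ha hb]
  | @cons x z y h p ih =>
    obtain ⟨c, hc⟩ := exists_isAncestor hK (hp z (by simp))
    have hcb : (K.levelGraph n).edist c b ≤ p.length :=
      ih (fun w hw => hp w (List.mem_cons_of_mem x hw)) hc hb
    have hac : (K.levelGraph n).edist a c ≤ 1 := by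
      rcases (historyGraph_adj.1 h).2 with h | h
      · exact levelGraph_edist_le_one_of_historyEdge hK h ha hc
      · exact SimpleGraph.edist_comm.trans_le (levelGraph_edist_le_one_of_historyEdge hK h hc ha)
    calc (K.levelGraph n).edist a b
        ≤ (K.levelGraph n).edist a c + (K.levelGraph n).edist c b := SimpleGraph.edist_triangle
      _ ≤ 1 + p.length := add_le_add hac hcb
      _ = (SimpleGraph.Walk.cons h p).length := by simp [add_comm]

end HistoryGraph

section LimitRay

variable (hK : K.IsFinite) (p q : K.limitSet)

/-- The path in the history graph through the cells around a limit point. -/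
noncomputable def limitRay (n : ℕ) : K.HistoryVertex := some ⟨n, limitCell hK p n⟩

theorem isAncestor_limitCell (hnm : n ≤ m) : IsAncestor (limitCell hK p n) (limitRay hK p m) :=
  ⟨hnm, limitCell_subset hK p hnm⟩

theorem depth_limitRay (n : ℕ) : depth (limitRay hK p n) = n + 1 := rfl

theorem dist_limitRay (i j : ℕ) :
    (K.historyGraph.dist (limitRay hK p i) (limitRay hK p j) : ℤ) = |(i : ℤ) - j| := by
  wlog hij : i ≤ j generalizing i j
  · rw [SimpleGraph.dist_comm, abs_sub_comm]
    exact this j i (le_of_not_ge hij)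
  have hle : K.historyGraph.dist (limitRay hK p i) (limitRay hK p j) + i + 1 ≤ j + 1 :=
    dist_add_le_depth hK (isAncestor_limitCell hK p hij)
  have hge := depth_le_add_dist hK (limitRay hK p i) (limitRay hK p j)
  rw [depth_limitRay, depth_limitRay] at hge
  rw [abs_sub_comm, abs_of_nonneg (by omega)]
  omega

theorem dist_limitRay_le (i j : ℕ) :
    K.historyGraph.dist (limitRay hK p i) (limitRay hK q j) ≤ i + j + 2 :=
  (dist_le_depth_add_depth hK _ _).trans_eq (by rw [depth_limitRay, depth_limitRay]; omega)

variable {p q}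

theorem exists_depth_le_of_not_reachable {l i j : ℕ} (hi : l ≤ i) (hj : l ≤ j)
    (hpq : ¬ (K.levelGraph l).Reachable (limitCell hK p l) (limitCell hK q l))
    (w : K.historyGraph.Walk (limitRay hK p i) (limitRay hK q j)) :
    ∃ z ∈ w.support, depth z ≤ l := by
  by_contra! hdeep
  have hedist := levelGraph_edist_le_length hK w hdeep (isAncestor_limitCell hK p hi)
    (isAncestor_limitCell hK q hj)
  exact hpq (SimpleGraph.reachable_of_edist_ne_top
    (ne_top_of_le_ne_top (ENat.natCast_ne_top w.length) hedist))

theorem exists_add_le_dist_limitRay (hpq : (p : ConnectedComponents K.limitSet) ≠ q) :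
    ∃ l, ∀ i j, i + j ≤ K.historyGraph.dist (limitRay hK p i) (limitRay hK q j) + 2 * l := by
  obtain ⟨l, hl⟩ := not_forall.1 ((connectedComponents_eq_iff hK p q).not.1 hpq)
  refine ⟨l, fun i j => ?_⟩
  have hpq := depth_le_add_dist hK (limitRay hK p i) (limitRay hK q j)
  have hqp := depth_le_add_dist hK (limitRay hK q j) (limitRay hK p i)
  rw [SimpleGraph.dist_comm] at hqp
  simp only [depth_limitRay] at hpq hqp
  by_cases hij : l ≤ i ∧ l ≤ j
  · obtain ⟨w, hw⟩ := (historyGraph_connected hK).exists_walk_length_eq_dist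
      (limitRay hK p i) (limitRay hK q j)
    obtain ⟨z, hz, hzl⟩ := exists_depth_le_of_not_reachable hK hij.1 hij.2 hl w
    have hzw := dist_add_dist_le_length_of_mem_support w hz
    have hpz := depth_le_add_dist hK z (limitRay hK p i)
    have hzq := depth_le_add_dist hK z (limitRay hK q j)
    rw [SimpleGraph.dist_comm] at hpz
    simp only [depth_limitRay] at hpz hzq
    omega
  · omega

theorem exists_dist_limitRay_le [hne : Nonempty K.limitSet] :
    ∃ E, ∀ x : K.HistoryVertex, ∃ p n, K.historyGraph.dist x (limitRay hK p n) ≤ E := by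
  obtain ⟨N, hN⟩ := exists_edist_limitCell_le hK
  refine ⟨N + 2, fun x => ?_⟩
  rcases le_or_gt (depth x) N with hx | hx
  · obtain ⟨p⟩ := hne
    refine ⟨p, 0, (dist_le_depth_add_depth hK _ _).trans ?_⟩
    rw [depth_limitRay]
    omega
  rcases x with _ | ⟨k, v⟩
  · exact (Nat.not_lt_zero N hx).elim
  obtain ⟨n, rfl⟩ := Nat.exists_eq_add_of_le' (Nat.lt_succ_iff.1 hx)
  obtain ⟨a, p, hva, hap⟩ := hN n v
  have hvertical := dist_add_le_depth hK (x := some ⟨n + N, v⟩) ⟨Nat.le_add_right n N, hva⟩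
  have hhorizontal : K.historyGraph.dist (some ⟨n, a⟩) (limitRay hK p n) ≤ 2 :=
    ENat.toNat_le_of_le_natCast ((historyGraph_edist_le _ _).trans hap)
  have htriangle := (historyGraph_connected hK).dist_triangle
    (u := some ⟨n + N, v⟩) (v := some ⟨n, a⟩) (w := limitRay hK p n)
  rw [SimpleGraph.dist_comm, depth_some] at hvertical
  exact ⟨p, n, by omega⟩

end LimitRay

end RComplex

namespace RComplex

variable {d : ℕ} {R : SubdivisionRule.{u} d} {K : RComplex.{u, v} R}

section CoarseHeight

variable {g : K.HistoryVertex → ℝ} {δ : ℝ} {n B : ℕ}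

theorem sign_eq_of_reachable (hK : K.IsFinite) (h : IsCoarseHeight K.historyGraph none g δ B)
    (hn : B ≤ n) {a b : K.LevelVertex n} (hab : (K.levelGraph n).Reachable a b) :
    SignType.sign (g (some ⟨n, a⟩)) = SignType.sign (g (some ⟨n, b⟩)) := by
  obtain ⟨p⟩ := hab
  refine h.sign_eq_of_walk (p.map (levelHom n)) fun z hz => ?_
  have hmap := p.support_map (levelHom n)
  obtain ⟨c, -, rfl⟩ := List.mem_map.1 (hmap ▸ hz)
  rw [dist_origin hK]
  exact Nat.lt_succ_of_le hn

theorem sign_eq_of_isAncestor (hK : K.IsFinite) (h : IsCoarseHeight K.historyGraph none g δ B)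
    (hn : B ≤ n) {a : K.LevelVertex n} {x : K.HistoryVertex} (hax : IsAncestor a x) :
    SignType.sign (g (some ⟨n, a⟩)) = SignType.sign (g x) := by
  obtain ⟨p, -, hp⟩ := exists_vertical_walk hK hax
  exact h.sign_eq_of_walk p fun z hz => (dist_origin hK z).symm ▸ hn.trans_lt (hp z hz)

theorem sign_limitRay_eq (hK : K.IsFinite) (h : IsCoarseHeight K.historyGraph none g δ B)
    (p : K.limitSet) (hn : B ≤ n) :
    SignType.sign (g (limitRay hK p n)) = SignType.sign (g (limitRay hK p B)) :=
  (sign_eq_of_isAncestor hK h le_rfl (isAncestor_limitCell hK p hn)).symm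

theorem exists_sign_limitRay_eq_one (hK : K.IsFinite)
    (h : IsCoarseHeight K.historyGraph none g δ B) :
    ∃ p, SignType.sign (g (limitRay hK p B)) = 1 := by
  have := finite_levelVertex hK B
  set S : Set (K.LevelVertex B) := {a | SignType.sign (g (some ⟨B, a⟩)) = 1}
  have hclosed : IsClosed (⋃ a ∈ S, closure a.1) :=
    S.toFinite.isClosed_biUnion fun _ _ => isClosed_closure
  have hmeets : ∀ m, ((⋃ a ∈ S, closure a.1) ∩ K.limitLevel m).Nonempty := fun m => by
    obtain ⟨x, hx, hpos⟩ := h.exists_pos_of_lt_dist (historyGraph_connected hK) (B + m)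
    rw [dist_origin hK] at hx
    obtain ⟨a, ha⟩ := exists_isAncestor hK (n := B) (x := x) (by omega)
    obtain ⟨b, hb⟩ := exists_isAncestor hK (n := m) (x := x) (by omega)
    have haS : a ∈ S := (sign_eq_of_isAncestor hK h le_rfl ha).trans (sign_pos hpos)
    rcases x with _ | ⟨k, c⟩
    · exact ha.elim
    obtain ⟨z, hz⟩ := nonempty_vertex c
    exact ⟨z, mem_biUnion haS (subset_closure (ha.2 hz)), b.2.2 (hb.2 hz)⟩
  obtain ⟨p, hp, hpL⟩ := nonempty_inter_limitSet hK hclosed hmeets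
  obtain ⟨a, haS, hpa⟩ := mem_iUnion₂.1 hp
  have hreachable := reachable_of_mem_closure hK (mem_limitCell hK ⟨p, hpL⟩ B) hpa
  exact ⟨⟨p, hpL⟩, (sign_eq_of_reachable hK h le_rfl hreachable).trans haS⟩

/-- Far below level `n` the two rays are within `2 * B` of each other, and a geodesic between them
that deep projects to level `n`. -/
theorem edist_limitCell_le (hK : K.IsFinite) (h : IsCoarseHeight K.historyGraph none g δ B)
    {p q : K.limitSet}
    (hpq : SignType.sign (g (limitRay hK p B)) = SignType.sign (g (limitRay hK q B))) (n : ℕ) :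
    (K.levelGraph n).edist (limitCell hK p n) (limitCell hK q n) ≤ (2 * B : ℕ) := by
  set k := n + B + 2 * B
  have hsign : SignType.sign (g (limitRay hK p k)) = SignType.sign (g (limitRay hK q k)) := by
    have hBk : B ≤ k := by omega
    rwa [sign_limitRay_eq hK h p hBk, sign_limitRay_eq hK h q hBk]
  have hdist : K.historyGraph.dist (limitRay hK p k) (limitRay hK q k) ≤ 2 * B :=
    h.dist_le_of_sign_eq (historyGraph_connected hK)
      (by rw [dist_origin hK, dist_origin hK, depth_limitRay, depth_limitRay]) hsign
  obtain ⟨w, hw⟩ := (historyGraph_connected hK).exists_walk_length_eq_dist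
    (limitRay hK p k) (limitRay hK q k)
  have hdeep : ∀ z ∈ w.support, n < depth z := fun z hz => by
    have hgeodesic := dist_add_dist_le_length_of_mem_support w hz
    have hdepth := depth_le_add_dist hK z (limitRay hK p k)
    rw [SimpleGraph.dist_comm, depth_limitRay] at hdepth
    omega
  exact (levelGraph_edist_le_length hK w hdeep (isAncestor_limitCell hK p (by omega))
    (isAncestor_limitCell hK q (by omega))).trans (Nat.cast_le.2 (hw.trans_le hdist))

theorem sign_limitRay_eq_iff (hK : K.IsFinite) (h : IsCoarseHeight K.historyGraph none g δ B)
    (p q : K.limitSet) :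
    SignType.sign (g (limitRay hK p B)) = SignType.sign (g (limitRay hK q B)) ↔
      (p : ConnectedComponents K.limitSet) = q := by
  refine ⟨fun hpq => (connectedComponents_eq_iff hK p q).2 fun n => ?_, fun hpq =>
    sign_eq_of_reachable hK h le_rfl ((connectedComponents_eq_iff hK p q).1 hpq B)⟩
  exact SimpleGraph.reachable_of_edist_ne_top
    (ne_top_of_le_ne_top (ENat.natCast_ne_top _) (edist_limitCell_le hK h hpq n))

theorem card_connectedComponents_eq_two (hK : K.IsFinite)
    (h : IsCoarseHeight K.historyGraph none g δ B) :
    Nat.card (ConnectedComponents K.limitSet) = 2 := by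
  obtain ⟨p, hp⟩ := exists_sign_limitRay_eq_one hK h
  obtain ⟨q, hq⟩ := exists_sign_limitRay_eq_one hK h.neg
  rw [Pi.neg_apply, Left.sign_neg, neg_eq_iff_eq_neg] at hq
  refine Nat.card_eq_two_iff.2 ⟨p, q, ?_, eq_univ_of_forall fun c => ?_⟩
  · rw [Ne, ← sign_limitRay_eq_iff hK h, hp, hq]
    decide
  · obtain ⟨r, rfl⟩ := ConnectedComponents.surjective_coe c
    rw [mem_insert_iff, mem_singleton_iff, ← sign_limitRay_eq_iff hK h,
      ← sign_limitRay_eq_iff hK h, hp, hq]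
    have hr := h.sign_ne_zero (x := limitRay hK r B) (by rw [dist_origin hK]; exact B.lt_succ_self)
    generalize SignType.sign (g (limitRay hK r B)) = s at hr ⊢
    decide +revert

theorem historyGraph_edist_le_of_reachable (hK : K.IsFinite)
    (h : IsCoarseHeight K.historyGraph none g δ B) {a b : K.LevelVertex n}
    (hab : (K.levelGraph n).Reachable a b) :
    K.historyGraph.edist (some ⟨n, a⟩) (some ⟨n, b⟩) ≤ (2 * B : ℕ) := by
  rw [← ((historyGraph_connected hK).preconnected _ _).coe_dist_eq_edist, Nat.cast_le]
  rcases lt_or_ge n B with hn | hn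
  · have := dist_le_depth_add_depth hK (some ⟨n, a⟩) (some ⟨n, b⟩)
    simp only [depth_some] at this
    omega
  · exact h.dist_le_of_sign_eq (historyGraph_connected hK)
      (by simp only [dist_origin hK, depth_some]) (sign_eq_of_reachable hK h hn hab)

theorem exists_levelGraph_edist_le_of_lt (hK : K.IsFinite) (B : ℕ) :
    ∃ D : ℕ, ∀ n < B, ∀ a b : K.LevelVertex n, (K.levelGraph n).Reachable a b →
      (K.levelGraph n).edist a b ≤ D := by
  have hlevel : ∀ n, ∃ D : ℕ, ∀ a b : K.LevelVertex n, (K.levelGraph n).dist a b ≤ D := fun n => by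
    have := finite_levelVertex hK n
    obtain ⟨D, hD⟩ := (finite_range (fun s : K.LevelVertex n × K.LevelVertex n =>
      (K.levelGraph n).dist s.1 s.2)).bddAbove
    exact ⟨D, fun a b => hD (mem_range_self (a, b))⟩
  choose D hD using hlevel
  refine ⟨(Finset.range B).sup D, fun n hn a b hab => ?_⟩
  rw [← hab.coe_dist_eq_edist, Nat.cast_le]
  exact (hD n a b).trans (Finset.le_sup (Finset.mem_range.2 hn))

theorem exists_levelGraph_edist_le_of_reachable (hK : K.IsFinite)
    (h : IsCoarseHeight K.historyGraph none g δ B) :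
    ∃ D : ℕ, ∀ (n : ℕ) (a b : K.LevelVertex n), (K.levelGraph n).Reachable a b →
      (a.1 ∩ K.limitSet).Nonempty → (b.1 ∩ K.limitSet).Nonempty →
      (K.levelGraph n).edist a b ≤ D := by
  obtain ⟨D, hD⟩ := exists_levelGraph_edist_le_of_lt (K := K) hK B
  refine ⟨max D (2 * B), fun n a b hab ha hb => ?_⟩
  rcases lt_or_ge n B with hn | hn
  · exact (hD n hn a b hab).trans (Nat.cast_le.2 (le_max_left D (2 * B)))
  obtain ⟨p, rfl⟩ := exists_limitCell_eq hK ha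
  obtain ⟨q, rfl⟩ := exists_limitCell_eq hK hb
  have hpq : SignType.sign (g (limitRay hK p B)) = SignType.sign (g (limitRay hK q B)) := by
    rw [← sign_limitRay_eq hK h p hn, ← sign_limitRay_eq hK h q hn]
    exact sign_eq_of_reachable hK h hn hab
  exact (edist_limitCell_le hK h hpq n).trans (Nat.cast_le.2 (le_max_right D (2 * B)))

end CoarseHeight

theorem quasiIsometric_int (hK : K.IsFinite)
    (hcard : Nat.card (ConnectedComponents K.limitSet) = 2) {D : ℕ}
    (hD : ∀ n p q, (K.levelGraph n).Reachable (limitCell hK p n) (limitCell hK q n) →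
      K.historyGraph.edist (limitRay hK p n) (limitRay hK q n) ≤ D) :
    QuasiIsometric (graphDist K.historyGraph) (fun m n : ℤ => dist m n) := by
  obtain ⟨c, c', hne, huniv⟩ := Nat.card_eq_two_iff.1 hcard
  obtain ⟨p, rfl⟩ := ConnectedComponents.surjective_coe c
  obtain ⟨q, rfl⟩ := ConnectedComponents.surjective_coe c'
  have : Nonempty K.limitSet := ⟨p⟩
  obtain ⟨E, hE⟩ := exists_dist_limitRay_le hK
  obtain ⟨l, hl⟩ := exists_add_le_dist_limitRay hK hne
  have hnear : ∀ r s : K.limitSet, (r : ConnectedComponents K.limitSet) = s → ∀ x n,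
      K.historyGraph.dist x (limitRay hK r n) ≤ E →
        K.historyGraph.dist x (limitRay hK s n) ≤ E + D := fun r s hrs x n hx => by
    have hedist := hD n r s ((connectedComponents_eq_iff hK r s).1 hrs n)
    exact (historyGraph_connected hK).dist_triangle.trans
      (add_le_add hx (ENat.toNat_le_of_le_natCast hedist))
  refine quasiIsometric_int_of_rays (historyGraph_connected hK) (dist_limitRay hK p)
    (dist_limitRay hK q) (C := 2 * l + 2) (E := E + D) (fun i j => ⟨?_, ?_⟩) fun x => ?_
  · have := dist_limitRay_le hK p q i j
    omega
  · have := hl i j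
    omega
  · obtain ⟨r, n, hr⟩ := hE x
    have hmem : (r : ConnectedComponents K.limitSet) ∈ ({↑p, ↑q} : Set _) :=
      huniv ▸ mem_univ _
    exact ⟨n, hmem.imp (hnear r p · x n hr) (hnear r q · x n hr)⟩

end RComplex

theorem mainTheorem9_general {d : ℕ} (R : SubdivisionRule.{u} d) (K : RComplex.{u, v} R)
    (hK : K.IsFinite) :
    (QuasiIsometric (graphDist K.historyGraph) (fun m n : ℤ => dist m n) ↔
      Nat.card (ConnectedComponents K.limitSet) = 2 ∧
      ∃ D : ℕ, ∀ (n : ℕ) (a b : K.LevelVertex n), K.SameComponent n a b →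
        K.historyGraph.edist (some ⟨n, a⟩) (some ⟨n, b⟩) ≤ D) ∧
    (QuasiIsometric (graphDist K.historyGraph) (fun m n : ℤ => dist m n) ↔
      Nat.card (ConnectedComponents K.limitSet) = 2 ∧
      ∃ D : ℕ, ∀ (n : ℕ) (a b : K.LevelVertex n), K.SameComponent n a b →
        (a.1 ∩ K.limitSet).Nonempty → (b.1 ∩ K.limitSet).Nonempty →
        (K.levelGraph n).edist a b ≤ D) := by
  simp only [RComplex.sameComponent_iff_reachable hK]
  refine ⟨⟨fun h => ?_, fun ⟨hcard, D, hD⟩ => ?_⟩, ⟨fun h => ?_, fun ⟨hcard, D, hD⟩ => ?_⟩⟩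
  · obtain ⟨g, δ, B, h⟩ := exists_isCoarseHeight_of_quasiIsometric none h
    exact ⟨RComplex.card_connectedComponents_eq_two hK h, 2 * B, fun n a b hab =>
      RComplex.historyGraph_edist_le_of_reachable hK h hab⟩
  · exact RComplex.quasiIsometric_int hK hcard fun n p q hpq => hD n _ _ hpq
  · obtain ⟨g, δ, B, h⟩ := exists_isCoarseHeight_of_quasiIsometric none h
    exact ⟨RComplex.card_connectedComponents_eq_two hK h,
      RComplex.exists_levelGraph_edist_le_of_reachable hK h⟩
  · refine RComplex.quasiIsometric_int hK hcard (D := D) fun n p q hpq => ?_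
    exact (RComplex.historyGraph_edist_le _ _).trans (hD n _ _ hpq
      ⟨p, RComplex.mem_limitCell hK p n, p.2⟩ ⟨q, RComplex.mem_limitCell hK q n, q.2⟩)

theorem mainTheorem9 {d : ℕ} (R : SubdivisionRule.{u} d) (K : RComplex.{u, v} R)
    (hK : K.IsFinite)
    {G : Type w} [Group G] (A : Set G) (hA : A.Finite) (hA' : Subgroup.closure A = ⊤)
    (hG : QuasiIsometric (graphDist K.historyGraph) (graphDist (SimpleGraph.mulCayley A))) :
    (QuasiIsometric (graphDist K.historyGraph) (fun m n : ℤ => dist m n) ↔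
      Nat.card (ConnectedComponents K.limitSet) = 2 ∧
      ∃ D : ℕ, ∀ (n : ℕ) (a b : K.LevelVertex n), K.SameComponent n a b →
        K.historyGraph.edist (some ⟨n, a⟩) (some ⟨n, b⟩) ≤ D) ∧
    (QuasiIsometric (graphDist K.historyGraph) (fun m n : ℤ => dist m n) ↔
      Nat.card (ConnectedComponents K.limitSet) = 2 ∧
      ∃ D : ℕ, ∀ (n : ℕ) (a b : K.LevelVertex n), K.SameComponent n a b →
        (a.1 ∩ K.limitSet).Nonempty → (b.1 ∩ K.limitSet).Nonempty →
        (K.levelGraph n).edist a b ≤ D) :=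
  mainTheorem9_general R K hK
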